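/- Setting. Let $\mathcal U\subset\mathbb R^d$ be a closed convex set containing the origin, with finite radius $D_2=\max_{u\in\mathcal U}\|u\|_2>0$. In each round $t=1,2,\dots$ the learner plays $w_t\in\mathcal U$, the environment chooses a convex loss $f_t:\mathcal U\to\mathbb R$, and the learner observes a (sub)gradient $g_t$ of $f_t$ at $w_t$, with $\|g_t\|_2\le G_2$, and a range bound $b_t$ with $\max_{u\in\mathcal U}|(u-w_t)^\top g_t|\le b_t\le 2D_2G_2$ (for instance $b_t=\max_{u\in\mathcal U}|(u-w_t)^\top g_t|$ or $b_t=\|g_t\|_2\max_{u,v\in\mathcal U}\|u-v\|_2$). Put $B_0=0$, $B_t=\max_{s\le t}b_s$, $\tilde R_T^u=\sum_{t=1}^T(w_t-u)^\top g_t$ and $V_T^u=\sum_{t=1}^T((u-w_t)^\top g_t)^2$. Algorithm (MetaGrad Full with $\sigma=D_2$; quotients $0/0$ are read as $0$). The set $\mathcal A_t$ of active learning rates is empty if $B_{t-1}=0$, and otherwise consists of all $\eta\in\{2^i:i\in\mathbb Z\}$ with $$\frac1{2\big(\sum_{s=1}^{t-1}b_s\frac{B_{s-1}}{B_s}+B_{t-1}\big)}<\eta\le\frac1{2B_{t-1}}.$$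 In the first round in which $\eta$ is active, its expert starts with $\check w^\eta=0$, $\Lambda^\eta=\sigma^{-2}I$, $\Sigma^\eta=\sigma^2I$ and weight $p(\eta)=1$. In round $t$ each active expert predicts $w_t^\eta=\arg\min_{u\in\mathcal U}(u-\check w_t^\eta)^\top\Lambda_t^\eta(u-\check w_t^\eta)$, and the controller plays $w_t=\sum_{\eta\in\mathcal A_t}p_t(\eta)\,\eta\,w_t^\eta\big/\sum_{\eta\in\mathcal A_t}p_t(\eta)\,\eta$ (and $w_t=0$ if $\mathcal A_t=\emptyset$). Then each active expert sets $$\Sigma_{t+1}^\eta=\Sigma_t^\eta-\frac{2\eta^2\Sigma_t^\eta g_tg_t^\top\Sigma_t^\eta}{1+2\eta^2g_t^\top\Sigma_t^\eta g_t},\quad \Lambda_{t+1}^\eta=\Lambda_t^\eta+2\eta^2g_tg_t^\top,\quad \check w_{t+1}^\eta=w_t^\eta-\big(1+2\eta(w_t^\eta-w_t)^\top g_t\big)\,\eta\,\Sigma_{t+1}^\eta g_t .$$ If $B_t>B_\tau\sum_{s=1}^tb_s/B_s$, where $\tau$ is the last round before $t$ after which this condition held ($\tau=0$ if there is none), then $p_{t+1}(\eta)=1$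 for all $\eta\in\mathcal A_t$. Otherwise, for all $\eta\in\mathcal A_t$, $$p_{t+1}(\eta)=\frac{p_t(\eta)e^{-\bar\ell_t^\eta(w_t^\eta)}}{\sum_{\nu\in\mathcal A_t}p_t(\nu)e^{-\bar\ell_t^\nu(w_t^\nu)}}\sum_{\nu\in\mathcal A_t}p_t(\nu),$$ where $\bar\ell_t^\eta(u)=\eta(u-w_t)^\top\bar g_t+(\eta(u-w_t)^\top\bar g_t)^2$ and $\bar g_t=\frac{B_{t-1}}{B_t}g_t$. Claim. Both of the following bounds hold, simultaneously, for every $u\in\mathcal U$. (i) For every $c>0$ there is a constant $C_c$, depending only on $c$, such that whenever $D_2G_2\ge c$ and $\ln\frac{D_2G_2T}{d}\ge c$, $$\tilde R_T^u\le C_c\left(\sqrt{V_T^u\,d\ln\tfrac{D_2G_2T}{d}}+D_2G_2\,d\ln\tfrac{D_2G_2T}{d}\right).$$ (ii) There is an absolute constant $C$ such that for all $T\ge3$, $$\tilde R_T^u\le C\,D_2G_2\sqrt{T\ln\ln T}.$$ -/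

import Mathlib

noncomputable section

namespace MetaGrad

/-- Parameter space `ℝ^d` with the Euclidean norm. -/
abbrev Vec (d : ℕ) : Type := EuclideanSpace ℝ (Fin d)

/-! Rounds are numbered `1, 2, 3, …`; the value of a sequence at index `0` is never used. -/

/-! ## Online convex optimization -/

/-- `g` is a subgradient at `w` of the function `f` on the domain `U`. -/
def IsSubgradient {d : ℕ} (U : Set (Vec d)) (f : Vec d → ℝ) (w g : Vec d) : Prop :=
  ∀ u ∈ U, f w + inner ℝ g (u - w) ≤ f u

/-- `b` bounds the effective size `max_{v ∈ U} |(v - w)ᵀ g|` of the gradient `g` at `w`. -/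
def IsRangeBound {d : ℕ} (U : Set (Vec d)) (w g : Vec d) (b : ℝ) : Prop :=
  ∀ v ∈ U, |inner ℝ (v - w) g| ≤ b

/-- Linearized regret `∑_{t=1}^T (w_t - u)ᵀ g_t`. -/
def linRegret {d : ℕ} (w g : ℕ → Vec d) (T : ℕ) (u : Vec d) : ℝ :=
  ∑ t ∈ Finset.Icc 1 T, inner ℝ (w t - u) (g t)

/-- The variance `V_T^u = ∑_{t=1}^T ((u - w_t)ᵀ g_t)²`. -/
def variance {d : ℕ} (w g : ℕ → Vec d) (T : ℕ) (u : Vec d) : ℝ :=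
  ∑ t ∈ Finset.Icc 1 T, (inner ℝ (u - w t) (g t)) ^ 2

/-! ## Quantities monitored by the controller -/

/-- Running maximum `B_t = max_{1 ≤ s ≤ t} b_s`, with `B_0 = 0` (all `b_s` are nonnegative). -/
def runMax (b : ℕ → ℝ) : ℕ → ℝ
  | 0 => 0
  | t + 1 => max (runMax b t) (b (t + 1))

/-- The grid `{2^i : i ∈ ℤ}` of candidate learning rates. -/
def grid : Set ℝ := Set.range fun i : ℤ => (2 : ℝ) ^ i

/-- The set of learning rates that are active in round `t`. -/
def activeSet (b : ℕ → ℝ) (t : ℕ) : Set ℝ :=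
  {η | 0 < runMax b (t - 1) ∧ η ∈ grid ∧
    1 / (2 * (∑ s ∈ Finset.Icc 1 (t - 1), b s * (runMax b (s - 1) / runMax b s)
      + runMax b (t - 1))) < η ∧
    η ≤ 1 / (2 * runMax b (t - 1))}

/-- The clipped gradient `(B_{t-1} / B_t) g_t`. -/
def clippedGrad {d : ℕ} (b : ℕ → ℝ) (g : ℕ → Vec d) (t : ℕ) : Vec d :=
  (runMax b (t - 1) / runMax b t) • g t

/-- The surrogate loss of `u` with learning rate `η`, for the gradient `g` at the controller's
iterate `w`. The clipped surrogate loss is this loss for the clipped gradient. -/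
def surrogate {d : ℕ} (η : ℝ) (w g u : Vec d) : ℝ :=
  η * inner ℝ (u - w) g + (η * inner ℝ (u - w) g) ^ 2

/-- The test, after round `t`, for a reset in an epoch that started at time `τ + 1`. -/
def NeedsReset (b : ℕ → ℝ) (τ t : ℕ) : Prop :=
  runMax b t > runMax b τ * ∑ s ∈ Finset.Icc 1 t, b s / runMax b s

/-! ## The algorithm -/

/-- Matrix-vector product on `ℝ^d`. -/
def mulV {d : ℕ} (M : Matrix (Fin d) (Fin d) ℝ) (x : Vec d) : Vec d :=
  WithLp.toLp 2 (M.mulVec x.ofLp)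

/-- The memory of the algorithm between two rounds. The state of an `η`-expert keeps its initial
value until the first round in which the expert is active. -/
structure State (d : ℕ) where
  /-- unprojected iterate of the `η`-expert -/
  wCheck : ℝ → Vec d
  /-- precision matrix of the `η`-expert -/
  Lam : ℝ → Matrix (Fin d) (Fin d) ℝ
  /-- covariance matrix of the `η`-expert -/
  Sig : ℝ → Matrix (Fin d) (Fin d) ℝ
  /-- the controller's weight on the `η`-expert -/
  wt : ℝ → ℝ
  /-- the number `τ` of the last round before the current epoch -/
  epoch : ℕ

/-- The initial state, for an estimate `σ` of the norm of the comparator. -/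
def initState (d : ℕ) (σ : ℝ) : State d where
  wCheck := fun _ => 0
  Lam := fun _ => (1 / σ ^ 2) • (1 : Matrix (Fin d) (Fin d) ℝ)
  Sig := fun _ => (σ ^ 2) • (1 : Matrix (Fin d) (Fin d) ℝ)
  wt := fun _ => 1
  epoch := 0

/-- `v` minimizes `(v - x)ᵀ Λ (v - x)` over `U`. -/
def IsProjection {d : ℕ} (U : Set (Vec d)) (L : Matrix (Fin d) (Fin d) ℝ) (x v : Vec d) : Prop :=
  v ∈ U ∧ ∀ u ∈ U, inner ℝ (v - x) (mulV L (v - x)) ≤ inner ℝ (u - x) (mulV L (u - x))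

/-- The projection of `x` onto `U` in the norm given by `Λ` (it exists and is unique if `U` is
nonempty, closed and convex and `Λ` is positive definite). -/
def project {d : ℕ} (U : Set (Vec d)) (L : Matrix (Fin d) (Fin d) ℝ) (x : Vec d) : Vec d :=
  Classical.epsilon fun v => IsProjection U L x v

/-- The prediction of the `η`-expert, given the current state and domain. -/
def expertPred {d : ℕ} (U : Set (Vec d)) (S : State d) (η : ℝ) : Vec d :=
  project U (S.Lam η) (S.wCheck η)

open Classical in
/-- The controller's prediction in round `t`: the average of the active experts' predictions under
weights tilted by the learning rates, and `0` if nobody is active. -/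
def controllerPred {d : ℕ} (b : ℕ → ℝ) (t : ℕ) (U : Set (Vec d)) (S : State d) : Vec d :=
  if activeSet b t = ∅ then 0
  else (∑ᶠ η ∈ activeSet b t, S.wt η * η)⁻¹ •
    ∑ᶠ η ∈ activeSet b t, (S.wt η * η) • expertPred U S η

/-- The updated covariance matrix of an expert (Sherman–Morrison formula). -/
def sigUpdate {d : ℕ} (η : ℝ) (Sg : Matrix (Fin d) (Fin d) ℝ) (g : Vec d) :
    Matrix (Fin d) (Fin d) ℝ :=
  Sg - (2 * η ^ 2 / (1 + 2 * η ^ 2 * inner ℝ g (mulV Sg g))) •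
    Matrix.vecMulVec (Sg.mulVec g.ofLp) (Sg.vecMul g.ofLp)

/-- The updated precision matrix of an expert. -/
def lamUpdate {d : ℕ} (η : ℝ) (L : Matrix (Fin d) (Fin d) ℝ) (g : Vec d) :
    Matrix (Fin d) (Fin d) ℝ :=
  L + (2 * η ^ 2) • Matrix.vecMulVec g.ofLp g.ofLp

open Classical in
/-- The update of all active experts and of the controller after round `t`, in which the domain was
`U` and the gradient was `g t`. Nothing changes for the learning rates that are not active. -/
def step {d : ℕ} (g : ℕ → Vec d) (b : ℕ → ℝ) (t : ℕ) (U : Set (Vec d)) (S : State d) :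
    State d where
  wCheck := fun η =>
    if η ∈ activeSet b t then
      expertPred U S η -
        ((1 + 2 * η * inner ℝ (expertPred U S η - controllerPred b t U S) (g t)) * η) •
          mulV (sigUpdate η (S.Sig η) (g t)) (g t)
    else S.wCheck η
  Lam := fun η => if η ∈ activeSet b t then lamUpdate η (S.Lam η) (g t) else S.Lam η
  Sig := fun η => if η ∈ activeSet b t then sigUpdate η (S.Sig η) (g t) else S.Sig η
  wt := fun η =>
    if η ∈ activeSet b t then
      if NeedsReset b S.epoch t then 1
      else
        let q : ℝ → ℝ := fun ν => S.wt ν * Real.exp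
          (-surrogate ν (controllerPred b t U S) (clippedGrad b g t) (expertPred U S ν))
        q η / (∑ᶠ ν ∈ activeSet b t, q ν) * ∑ᶠ ν ∈ activeSet b t, S.wt ν
    else S.wt η
  epoch := if NeedsReset b S.epoch t then t else S.epoch

/-- The state after `t` rounds, for domains `U`, gradients `g` and range bounds `b`. -/
def state {d : ℕ} (σ : ℝ) (U : ℕ → Set (Vec d)) (g : ℕ → Vec d) (b : ℕ → ℝ) : ℕ → State d
  | 0 => initState d σ
  | t + 1 => step g b (t + 1) (U (t + 1)) (state σ U g b t)

/-- The iterate `w_t` of the full matrix version of MetaGrad. It depends only on the domains up to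
round `t` and on the gradients and range bounds before round `t`. -/
def iterate {d : ℕ} (σ : ℝ) (U : ℕ → Set (Vec d)) (g : ℕ → Vec d) (b : ℕ → ℝ) (t : ℕ) : Vec d :=
  controllerPred b t (U t) (state σ U g b (t - 1))

end MetaGrad

end

/-! The heart is `mul_linRegret_le`. For every grid rate `η` with `2 η B_T ≤ 1`, even one that is
never active, `η R ≤ η² V + O(log log T) + ∑ 2 η² gᵀ Σ g`, where the sum runs over the active rounds
and `Σ` is the covariance after the update. The algorithm knows neither `u` nor the best `η`, so the
analysis may choose `η` afterwards: `le_of_forall_grid` minimizes over the grid at the cost of a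
constant factor.

On an active round, `η (w - u)ᵀ g` is the expert's surrogate loss minus that of `u`, minus the
expert's surrogate loss, plus `(η (u - w)ᵀ g)²`. Three estimates complete the fixed-rate bound. Each
expert is an online Newton method (`expert_regret_le`): the potential `(w̌ - u)ᵀ Λ (w̌ - u)`
telescopes and leaves `∑ 2 η² gᵀ Σ g`. The controller plays an `η`-tilted average, so `e^{-x-x²} ≤ 1
- x` makes its exponential-weights update lose only the log of the number of rates, within one epoch
(`neg_activeSum_clippedLoss_le`). Without a reset, `B` grows by at most a factor `T`, so there are
`O(log T)` rates. A reset makes all epochs but the last two negligible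
(`activeSum_neg_surrogate_le_log`), and clipping costs a telescoping sum of increments of `B`.
Rounds in which `η` is inactive, hence too small, contribute at most `1` (`sum_sub_activeSum_le`).

The two claims estimate `∑ 2 η² gᵀ Σ g` differently. By `Σ ≤ σ² I` it is at most `2 η² σ² G² T`,
which joins `η² V` and leaves only `log log T` to pay. By the determinant-trace argument it is at
most `d log(1 + 2 η² σ² G² T / d)`, which keeps `V` intact. -/

noncomputable section

namespace MetaGrad

/-! ## Quadratic forms on `ℝ^d` -/

/-- The quadratic form `xᵀ L x`. -/
def quad {d : ℕ} (L : Matrix (Fin d) (Fin d) ℝ) (x : Vec d) : ℝ := inner ℝ x (mulV L x)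

lemma inner_eq_dotProduct {d : ℕ} (x y : Vec d) : inner ℝ x y = x.ofLp ⬝ᵥ y.ofLp := by
  rw [EuclideanSpace.inner_eq_star_dotProduct, dotProduct_comm]
  simp

lemma mulV_add {d : ℕ} (L : Matrix (Fin d) (Fin d) ℝ) (x y : Vec d) :
    mulV L (x + y) = mulV L x + mulV L y := by
  simp [mulV, Matrix.mulVec_add]

lemma mulV_smul {d : ℕ} (L : Matrix (Fin d) (Fin d) ℝ) (a : ℝ) (x : Vec d) :
    mulV L (a • x) = a • mulV L x := by
  simp [mulV, Matrix.mulVec_smul]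

lemma mulV_smul_one {d : ℕ} (a : ℝ) (x : Vec d) :
    mulV (a • (1 : Matrix (Fin d) (Fin d) ℝ)) x = a • x := by
  simp [mulV, Matrix.smul_mulVec]

lemma mulV_mulV {d : ℕ} {L S : Matrix (Fin d) (Fin d) ℝ} (h : L * S = 1) (x : Vec d) :
    mulV L (mulV S x) = x := by
  simp [mulV, Matrix.mulVec_mulVec, h]

lemma inner_mulV_symm {d : ℕ} {L : Matrix (Fin d) (Fin d) ℝ} (hL : L.IsHermitian) (x y : Vec d) :
    inner ℝ x (mulV L y) = inner ℝ y (mulV L x) := by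
  have h : L.transpose = L := by simpa using hL.eq
  simp only [inner_eq_dotProduct, mulV]
  rw [Matrix.dotProduct_mulVec, ← Matrix.mulVec_transpose, h, dotProduct_comm]

lemma quad_add_smul {d : ℕ} {L : Matrix (Fin d) (Fin d) ℝ} (hL : L.IsHermitian) (x y : Vec d)
    (a : ℝ) : quad L (x + a • y) = quad L x + 2 * a * inner ℝ x (mulV L y) + a ^ 2 * quad L y := by
  simp only [quad, mulV_add, mulV_smul, inner_add_left, inner_add_right, inner_smul_left,
    inner_smul_right, inner_mulV_symm hL y x]
  simp
  ring

lemma mulV_lamUpdate {d : ℕ} (η : ℝ) (L : Matrix (Fin d) (Fin d) ℝ) (g x : Vec d) :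
    mulV (lamUpdate η L g) x = mulV L x + (2 * η ^ 2 * inner ℝ x g) • g := by
  have h : inner ℝ x g = g.ofLp ⬝ᵥ x.ofLp := by rw [inner_eq_dotProduct, dotProduct_comm]
  ext i
  simp [mulV, lamUpdate, Matrix.add_mulVec, Matrix.smul_mulVec, Matrix.vecMulVec_mulVec, h]
  ring

lemma quad_lamUpdate {d : ℕ} (η : ℝ) (L : Matrix (Fin d) (Fin d) ℝ) (g x : Vec d) :
    quad (lamUpdate η L g) x = quad L x + 2 * η ^ 2 * inner ℝ x g ^ 2 := by
  simp only [quad, mulV_lamUpdate, inner_add_right, inner_smul_right]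
  ring

/-! ## Projections -/

lemma isProjection_project {d : ℕ} {U : Set (Vec d)} (hU : IsCompact U) (hne : U.Nonempty)
    (L : Matrix (Fin d) (Fin d) ℝ) (x : Vec d) : IsProjection U L x (project U L x) := by
  apply Classical.epsilon_spec (p := fun v => IsProjection U L x v)
  have hc : Continuous fun v : Vec d => inner ℝ (v - x) (mulV L (v - x)) := by
    have : Continuous fun v : Vec d => mulV L (v - x) := by
      unfold mulV
      fun_prop
    fun_prop
  obtain ⟨v, hv, hmin⟩ := hU.exists_isMinOn hne hc.continuousOn
  exact ⟨v, hv, fun u hu => hmin hu⟩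

/-- The obtuse-angle inequality `B ≥ 0` at the projection makes the cross term in the expansion of
`quad L (x - u)` nonnegative. -/
lemma IsProjection.quad_sub_le {d : ℕ} {U : Set (Vec d)} (hconv : Convex ℝ U)
    {L : Matrix (Fin d) (Fin d) ℝ} (hL : L.IsHermitian) (hpos : ∀ z, 0 ≤ quad L z)
    {x y u : Vec d} (hy : IsProjection U L x y) (hu : u ∈ U) :
    quad L (y - u) ≤ quad L (x - u) := by
  set B := inner ℝ (y - x) (mulV L (u - y)) with hB
  have hBnonneg : 0 ≤ B := by
    by_contra! hneg
    set q := quad L (u - y)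
    have hq : 0 ≤ q := hpos _
    -- A step towards `u` short enough that the linear gain `2B` beats the quadratic cost `a q`. The
    -- `+ 1` covers `q = 0`.
    set a := min 1 (-B / (q + 1))
    have ha : 0 < a := lt_min one_pos (div_pos (by linarith) (by linarith))
    have ha1 : a ≤ 1 := min_le_left _ _
    have ha2 : a * (q + 1) ≤ -B := by
      rw [← le_div_iff₀ (by linarith)]
      exact min_le_right _ _
    have hmem : y + a • (u - y) ∈ U := hconv.add_smul_sub_mem hy.1 hu ⟨ha.le, ha1⟩
    have h := hy.2 _ hmem
    have e : y + a • (u - y) - x = (y - x) + a • (u - y) := by abel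
    rw [e] at h
    change quad L (y - x) ≤ quad L ((y - x) + a • (u - y)) at h
    rw [quad_add_smul hL] at h
    have h' : 0 ≤ a * (2 * B + a * q) := by
      have : 0 ≤ 2 * a * B + a ^ 2 * q := by linarith
      nlinarith
    have := nonneg_of_mul_nonneg_right h' ha
    nlinarith
  have e : x - u = -1 • ((y - x) + (1 : ℝ) • (u - y)) := by
    rw [one_smul]
    simp
  have hneg : ∀ z : Vec d, quad L (-1 • z) = quad L z := by
    intro z
    have := quad_add_smul hL 0 z (-1)
    have h0 : quad L 0 = 0 := by simp [quad]
    simp only [zero_add, h0, inner_zero_left] at this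
    have e : ((-1 : ℤ) • z) = ((-1 : ℝ) • z) := by simp
    rw [e, this]
    ring
  have hyu : quad L (y - u) = quad L (u - y) := by
    rw [← hneg (u - y)]
    congr 1
    simp
  rw [e, hneg, quad_add_smul hL, hyu]
  have := hpos (y - x)
  linarith

/-! ## Rank-one updates of precision and covariance matrices -/

/-- `S` is the inverse of the symmetric matrix `L`, whose eigenvalues are at least `1 / σ²`. -/
structure IsPrecisionPair {d : ℕ} (σ : ℝ) (L S : Matrix (Fin d) (Fin d) ℝ) : Prop where
  isHermitian : L.IsHermitian
  coercive : ∀ x, ‖x‖ ^ 2 / σ ^ 2 ≤ quad L x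
  mul_eq_one : L * S = 1

namespace IsPrecisionPair

variable {d : ℕ} {σ : ℝ} {L S : Matrix (Fin d) (Fin d) ℝ}

lemma quad_nonneg (h : IsPrecisionPair σ L S) (x : Vec d) : 0 ≤ quad L x :=
  le_trans (by positivity) (h.coercive x)

lemma posDef (h : IsPrecisionPair σ L S) (hσ : 0 < σ) : L.PosDef := by
  refine Matrix.PosDef.of_dotProduct_mulVec_pos h.isHermitian fun x hx => ?_
  have h1 := h.coercive (WithLp.toLp 2 x)
  have h2 : 0 < ‖(WithLp.toLp 2 x : Vec d)‖ ^ 2 / σ ^ 2 := by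
    have : 0 < ‖(WithLp.toLp 2 x : Vec d)‖ := by simpa using hx
    positivity
  have h3 : quad L (WithLp.toLp 2 x) = star x ⬝ᵥ L.mulVec x := by
    simp [quad, inner_eq_dotProduct, mulV]
  linarith

lemma quad_cov_eq (h : IsPrecisionPair σ L S) (g : Vec d) :
    quad S g = quad L (mulV S g) := by
  rw [quad, quad, mulV_mulV h.mul_eq_one, real_inner_comm]

lemma quad_cov_nonneg (h : IsPrecisionPair σ L S) (g : Vec d) : 0 ≤ quad S g := by
  rw [h.quad_cov_eq]
  exact h.quad_nonneg _

/-- Coercivity at `S g` together with Cauchy–Schwarz gives `‖S g‖ ≤ σ² ‖g‖`; no spectral theory is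
needed. -/
lemma quad_cov_le (h : IsPrecisionPair σ L S) (hσ : 0 < σ) (g : Vec d) :
    quad S g ≤ σ ^ 2 * ‖g‖ ^ 2 := by
  have h1 := h.coercive (mulV S g)
  rw [← h.quad_cov_eq, div_le_iff₀ (by positivity)] at h1
  have h2 : quad S g ≤ ‖g‖ * ‖mulV S g‖ := real_inner_le_norm _ _
  set m := ‖mulV S g‖
  have hm : 0 ≤ m := norm_nonneg _
  have hg : 0 ≤ ‖g‖ := norm_nonneg _
  have h3 : m ≤ ‖g‖ * σ ^ 2 := by
    rcases hm.eq_or_lt with h0 | h0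
    · rw [← h0]; positivity
    · have : m * m ≤ ‖g‖ * σ ^ 2 * m := by nlinarith [sq_nonneg σ]
      exact le_of_mul_le_mul_right this h0
  nlinarith

lemma smul_one (hσ : 0 < σ) : IsPrecisionPair (d := d) σ ((1 / σ ^ 2) • 1) ((σ ^ 2) • 1) where
  isHermitian := by
    ext i j
    simp [Matrix.one_apply, eq_comm]
  coercive x := by
    rw [quad, mulV_smul_one, inner_smul_right, real_inner_self_eq_norm_sq]
    exact le_of_eq (by ring)
  mul_eq_one := by
    have : σ ^ 2 ≠ 0 := by positivity
    simp [smul_smul, this]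

lemma update (h : IsPrecisionPair σ L S) (η : ℝ) (g : Vec d) :
    IsPrecisionPair σ (lamUpdate η L g) (sigUpdate η S g) where
  isHermitian := by
    have hL : L.transpose = L := by simpa using h.isHermitian.eq
    rw [Matrix.IsHermitian]
    ext i j
    have := congrFun (congrFun hL i) j
    simp only [Matrix.transpose_apply] at this
    simp [lamUpdate, Matrix.vecMulVec_apply, this, mul_comm]
  coercive x := by
    rw [quad_lamUpdate]
    have := h.coercive x
    have : 0 ≤ 2 * η ^ 2 * inner ℝ x g ^ 2 := by positivity
    linarith
  mul_eq_one := by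
    have hs := h.quad_cov_nonneg g
    set s := quad S g with hsdef
    have hs' : inner ℝ g (mulV S g) = s := rfl
    have hdot : g.ofLp ⬝ᵥ S.mulVec g.ofLp = s := by
      rw [hsdef, quad, inner_eq_dotProduct]; rfl
    have hpos : 1 + 2 * η ^ 2 * s ≠ 0 := by positivity
    have hLS : L.mulVec (S.mulVec g.ofLp) = g.ofLp := by
      rw [Matrix.mulVec_mulVec, h.mul_eq_one, Matrix.one_mulVec]
    have hL : L * Matrix.vecMulVec (S.mulVec g.ofLp) (S.vecMul g.ofLp) =
        Matrix.vecMulVec g.ofLp (S.vecMul g.ofLp) := by rw [Matrix.mul_vecMulVec, hLS]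
    have hg : Matrix.vecMulVec g.ofLp g.ofLp *
        Matrix.vecMulVec (S.mulVec g.ofLp) (S.vecMul g.ofLp) =
        s • Matrix.vecMulVec g.ofLp (S.vecMul g.ofLp) := by
      rw [Matrix.vecMulVec_mul_vecMulVec, hdot, Matrix.vecMulVec_smul]
    rw [lamUpdate, sigUpdate, hs', Matrix.mul_sub, Matrix.add_mul, Matrix.add_mul, h.mul_eq_one,
      Matrix.mul_smul, Matrix.smul_mul, hL, Matrix.smul_mul, Matrix.mul_smul, hg,
      Matrix.vecMulVec_mul]
    ext i j
    simp [Matrix.vecMulVec_apply]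
    field_simp
    ring

lemma quad_sigUpdate (h : IsPrecisionPair σ L S) (η : ℝ) (g : Vec d) :
    quad (sigUpdate η S g) g = quad S g / (1 + 2 * η ^ 2 * quad S g) := by
  have hs := h.quad_cov_nonneg g
  have hs' : inner ℝ g (mulV S g) = quad S g := rfl
  have hdot : g.ofLp ⬝ᵥ S.mulVec g.ofLp = quad S g := by
    rw [quad, inner_eq_dotProduct]; rfl
  have hpos : 1 + 2 * η ^ 2 * quad S g ≠ 0 := by positivity
  have hdot' : Matrix.vecMul g.ofLp S ⬝ᵥ g.ofLp = quad S g := by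
    rw [← Matrix.dotProduct_mulVec, hdot]
  have : quad (sigUpdate η S g) g =
      quad S g - 2 * η ^ 2 / (1 + 2 * η ^ 2 * quad S g) * (quad S g * quad S g) := by
    rw [quad, inner_eq_dotProduct, sigUpdate, hs', mulV, Matrix.sub_mulVec, dotProduct_sub,
      Matrix.smul_mulVec, Matrix.vecMulVec_mulVec, hdot', hdot]
    simp [hdot]
  rw [this]
  field_simp
  ring

lemma det_lamUpdate (h : IsPrecisionPair σ L S) (η : ℝ) (g : Vec d) :
    (lamUpdate η L g).det = L.det * (1 + 2 * η ^ 2 * quad S g) := by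
  have e : lamUpdate η L g =
      L * (1 + Matrix.vecMulVec ((2 * η ^ 2) • S.mulVec g.ofLp) g.ofLp) := by
    rw [Matrix.mul_add, Matrix.mul_one, Matrix.mul_vecMulVec, Matrix.mulVec_smul,
      Matrix.mulVec_mulVec, h.mul_eq_one, Matrix.one_mulVec, Matrix.smul_vecMulVec, lamUpdate]
  rw [e, Matrix.det_mul, Matrix.vecMulVec_eq (Fin 1),
    Matrix.det_one_add_replicateCol_mul_replicateRow, dotProduct_smul, quad, inner_eq_dotProduct]
  rfl

/-- With `x = 1 + 2 η² gᵀ S g`, the left side is `1 - 1/x`, and `x` is the ratio of the two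
determinants by the matrix determinant lemma. -/
lemma two_mul_sq_mul_quad_le_log (h : IsPrecisionPair σ L S) (hσ : 0 < σ) (η : ℝ) (g : Vec d) :
    2 * η ^ 2 * quad (sigUpdate η S g) g ≤
      Real.log (lamUpdate η L g).det - Real.log L.det := by
  have hs := h.quad_cov_nonneg g
  have hpos : 0 < 1 + 2 * η ^ 2 * quad S g := by positivity
  rw [h.det_lamUpdate, Real.log_mul (h.posDef hσ).det_pos.ne' hpos.ne', h.quad_sigUpdate]
  have := Real.one_sub_inv_le_log_of_pos hpos
  have e : 2 * η ^ 2 * (quad S g / (1 + 2 * η ^ 2 * quad S g)) =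
      1 - (1 + 2 * η ^ 2 * quad S g)⁻¹ := by
    field_simp
    ring
  linarith

/-- One round of an expert: `x` is the unprojected iterate, `y` the prediction, `z` the
controller's iterate. -/
lemma surrogate_sub_le (h : IsPrecisionPair σ L S) {U : Set (Vec d)} (hconv : Convex ℝ U)
    {x y z u g : Vec d} (hy : IsProjection U L x y) (hu : u ∈ U) {η : ℝ}
    (hz : |η * inner ℝ (y - z) g| ≤ 1 / 2) :
    surrogate η z g y - surrogate η z g u ≤
      (quad L (x - u) - quad (lamUpdate η L g)
        (y - ((1 + 2 * η * inner ℝ (y - z) g) * η) • mulV (sigUpdate η S g) g - u)) / 2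
      + 2 * η ^ 2 * quad (sigUpdate η S g) g := by
  have h' := h.update η g
  set α := (1 + 2 * η * inner ℝ (y - z) g) * η with hα
  set L' := lamUpdate η L g with hL'
  set S' := sigUpdate η S g
  have e : y - α • mulV S' g - u = (y - u) + (-α) • mulV S' g := by
    rw [neg_smul]; abel
  have hq : quad L' (y - α • mulV S' g - u) =
      quad L (y - u) + 2 * η ^ 2 * inner ℝ (y - u) g ^ 2 - 2 * α * inner ℝ (y - u) g
        + α ^ 2 * quad S' g := by
    rw [e, quad_add_smul h'.isHermitian, mulV_mulV h'.mul_eq_one, ← h'.quad_cov_eq, hL',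
      quad_lamUpdate]
    ring
  have hproj := hy.quad_sub_le hconv h.isHermitian h.quad_nonneg hu
  have hS := h'.quad_cov_nonneg g
  have hα2 : α ^ 2 ≤ 4 * η ^ 2 := by
    have : (1 + 2 * η * inner ℝ (y - z) g) ^ 2 ≤ 4 := by
      have := abs_le.mp hz
      nlinarith
    rw [hα, mul_pow]
    exact mul_le_mul_of_nonneg_right this (sq_nonneg η)
  have hmul := mul_le_mul_of_nonneg_right hα2 hS
  have hsub : inner ℝ (u - z) g = inner ℝ (y - z) g - inner ℝ (y - u) g := by
    rw [← inner_sub_left]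
    congr 1
    abel
  -- The surrogate is quadratic, so its expansion at `y` is exact, with slope `α`. The term `-η² ⟨y
  -- - u, g⟩²` is what the rank-one growth of the precision matrix absorbs.
  have hloss : surrogate η z g y - surrogate η z g u =
      α * inner ℝ (y - u) g - η ^ 2 * inner ℝ (y - u) g ^ 2 := by
    simp only [surrogate, hsub, hα]
    ring
  rw [hloss, hq]
  linarith

end IsPrecisionPair

/-- The determinant-trace inequality. -/
lemma log_det_le {d : ℕ} {L : Matrix (Fin d) (Fin d) ℝ} (hL : L.PosDef) {m : ℝ} (hm : 0 < m)
    (htr : L.trace ≤ d * m) : Real.log L.det ≤ d * Real.log m := by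
  have htr' : L.trace = ∑ i, hL.isHermitian.eigenvalues i := by
    simpa using hL.isHermitian.trace_eq_sum_eigenvalues
  have hdet : L.det = ∏ i, hL.isHermitian.eigenvalues i := by
    simpa using hL.isHermitian.det_eq_prod_eigenvalues
  have hev : ∀ i, 0 < hL.isHermitian.eigenvalues i := hL.eigenvalues_pos
  rw [hdet, Real.log_prod fun i _ => (hev i).ne']
  -- Tangent line of the logarithm at `m`.
  have h1 : ∀ i, Real.log (hL.isHermitian.eigenvalues i) ≤
      hL.isHermitian.eigenvalues i / m - 1 + Real.log m := by
    intro i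
    have := Real.log_le_sub_one_of_pos (div_pos (hev i) hm)
    rw [Real.log_div (hev i).ne' hm.ne'] at this
    linarith
  refine (Finset.sum_le_sum fun i _ => h1 i).trans ?_
  rw [Finset.sum_add_distrib, Finset.sum_sub_distrib, ← Finset.sum_div, ← htr']
  have : L.trace / m ≤ d := by rwa [div_le_iff₀ hm]
  simp
  linarith

lemma trace_lamUpdate {d : ℕ} (η : ℝ) (L : Matrix (Fin d) (Fin d) ℝ) (g : Vec d) :
    (lamUpdate η L g).trace = L.trace + 2 * η ^ 2 * ‖g‖ ^ 2 := by
  rw [lamUpdate, Matrix.trace_add, Matrix.trace_smul, Matrix.trace_vecMulVec,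
    ← inner_eq_dotProduct, real_inner_self_eq_norm_sq, smul_eq_mul]

/-! ## Sums over the active rounds of a learning rate -/

/-- The sum of `F s` over the rounds `r < s ≤ t` in which `η` is active. -/
def activeSum (b : ℕ → ℝ) (η : ℝ) (F : ℕ → ℝ) (r t : ℕ) : ℝ :=
  ∑ s ∈ Finset.Ioc r t, Set.indicator {s | η ∈ activeSet b s} F s

section activeSum

variable {b : ℕ → ℝ} {η : ℝ} {F H : ℕ → ℝ} {r m t : ℕ}

lemma activeSum_self : activeSum b η F r r = 0 := by simp [activeSum]

lemma activeSum_succ_of_mem (hrt : r ≤ t) (h : η ∈ activeSet b (t + 1)) :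
    activeSum b η F r (t + 1) = activeSum b η F r t + F (t + 1) := by
  rw [activeSum, Finset.sum_Ioc_succ_top hrt, activeSum, Set.indicator_of_mem (by exact h)]

lemma activeSum_succ_of_notMem (hrt : r ≤ t) (h : η ∉ activeSet b (t + 1)) :
    activeSum b η F r (t + 1) = activeSum b η F r t := by
  rw [activeSum, Finset.sum_Ioc_succ_top hrt, activeSum, Set.indicator_of_notMem (by exact h), add_zero]

lemma activeSum_add_activeSum (hrm : r ≤ m) (hmt : m ≤ t) :
    activeSum b η F r m + activeSum b η F m t = activeSum b η F r t :=
  Finset.sum_Ioc_consecutive _ hrm hmt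

lemma activeSum_le (h : ∀ s, r < s → s ≤ t → η ∈ activeSet b s → F s ≤ H s) :
    activeSum b η F r t ≤ activeSum b η H r t := by
  refine Finset.sum_le_sum fun s hs => ?_
  rw [Finset.mem_Ioc] at hs
  by_cases hm : η ∈ activeSet b s
  · rw [Set.indicator_of_mem (by exact hm), Set.indicator_of_mem (by exact hm)]
    exact h s hs.1 hs.2 hm
  · rw [Set.indicator_of_notMem (by exact hm), Set.indicator_of_notMem (by exact hm)]

lemma activeSum_le_sum (h : ∀ s, r < s → s ≤ t → 0 ≤ F s) :
    activeSum b η F r t ≤ ∑ s ∈ Finset.Ioc r t, F s := by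
  refine Finset.sum_le_sum fun s hs => ?_
  rw [Finset.mem_Ioc] at hs
  exact Set.indicator_apply_le' (fun _ => le_rfl) fun _ => h s hs.1 hs.2

lemma activeSum_add : activeSum b η (fun s => F s + H s) r t =
    activeSum b η F r t + activeSum b η H r t := by
  simp only [activeSum, ← Finset.sum_add_distrib]
  refine Finset.sum_congr rfl fun s _ => ?_
  by_cases hm : η ∈ activeSet b s <;> simp [Set.indicator, hm]

lemma activeSum_neg : activeSum b η (fun s => -F s) r t = -activeSum b η F r t := by
  simp only [activeSum, ← Finset.sum_neg_distrib]
  refine Finset.sum_congr rfl fun s _ => ?_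
  by_cases hm : η ∈ activeSet b s <;> simp [Set.indicator, hm]

lemma activeSum_eq_zero (h : ∀ s, r < s → s ≤ t → η ∉ activeSet b s) :
    activeSum b η F r t = 0 := by
  refine Finset.sum_eq_zero fun s hs => ?_
  rw [Finset.mem_Ioc] at hs
  exact Set.indicator_of_notMem (by exact h s hs.1 hs.2) _

end activeSum

/-! ## Regret of a single expert -/

/-- The prediction of the `η`-expert in round `t`. -/
def expertIterate {d : ℕ} (σ : ℝ) (U : Set (Vec d)) (g : ℕ → Vec d) (b : ℕ → ℝ) (η : ℝ) (t : ℕ) :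
    Vec d :=
  expertPred U (state σ (fun _ => U) g b (t - 1)) η

section expert

variable {d : ℕ} {σ : ℝ} {U : Set (Vec d)} {g : ℕ → Vec d} {b : ℕ → ℝ} {η : ℝ}

lemma state_succ_of_mem {t : ℕ} (h : η ∈ activeSet b (t + 1)) :
    (state σ (fun _ => U) g b (t + 1)).Lam η =
        lamUpdate η ((state σ (fun _ => U) g b t).Lam η) (g (t + 1)) ∧
      (state σ (fun _ => U) g b (t + 1)).Sig η =
        sigUpdate η ((state σ (fun _ => U) g b t).Sig η) (g (t + 1)) ∧
      (state σ (fun _ => U) g b (t + 1)).wCheck η = expertIterate σ U g b η (t + 1) -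
        ((1 + 2 * η * inner ℝ (expertIterate σ U g b η (t + 1) -
          iterate σ (fun _ => U) g b (t + 1)) (g (t + 1))) * η) •
          mulV (sigUpdate η ((state σ (fun _ => U) g b t).Sig η) (g (t + 1))) (g (t + 1)) := by
  refine ⟨?_, ?_, ?_⟩ <;> exact if_pos h

lemma state_succ_of_notMem {t : ℕ} (h : η ∉ activeSet b (t + 1)) :
    (state σ (fun _ => U) g b (t + 1)).Lam η = (state σ (fun _ => U) g b t).Lam η ∧
      (state σ (fun _ => U) g b (t + 1)).Sig η = (state σ (fun _ => U) g b t).Sig η ∧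
      (state σ (fun _ => U) g b (t + 1)).wCheck η = (state σ (fun _ => U) g b t).wCheck η ∧
      (state σ (fun _ => U) g b (t + 1)).wt η = (state σ (fun _ => U) g b t).wt η := by
  refine ⟨?_, ?_, ?_, ?_⟩ <;> exact if_neg h

lemma isPrecisionPair_state (hσ : 0 < σ) (U : Set (Vec d)) (g : ℕ → Vec d) (b : ℕ → ℝ) (η : ℝ)
    (t : ℕ) : IsPrecisionPair σ ((state σ (fun _ => U) g b t).Lam η)
      ((state σ (fun _ => U) g b t).Sig η) := by
  induction t with
  | zero => exact IsPrecisionPair.smul_one hσ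
  | succ t ih =>
    by_cases h : η ∈ activeSet b (t + 1)
    · obtain ⟨h1, h2, -⟩ := state_succ_of_mem (σ := σ) (U := U) (g := g) h
      rw [h1, h2]
      exact ih.update η _
    · obtain ⟨h1, h2, -⟩ := state_succ_of_notMem (σ := σ) (U := U) (g := g) h
      rwa [h1, h2]

lemma expertIterate_mem (hU : IsCompact U) (hne : U.Nonempty) (t : ℕ) :
    expertIterate σ U g b η t ∈ U :=
  (isProjection_project hU hne _ _).1

/-- The final potential is kept on the right so that the induction telescopes. An inactive round
freezes the expert and hence the potential. -/
lemma expert_regret_le_aux (hσ : 0 < σ) (hU : IsCompact U) (hconv : Convex ℝ U) {u : Vec d}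
    (hu : u ∈ U) {T : ℕ}
    (hη : ∀ s, 1 ≤ s → s ≤ T → |η * inner ℝ (expertIterate σ U g b η s -
      iterate σ (fun _ => U) g b s) (g s)| ≤ 1 / 2) :
    activeSum b η (fun s =>
        surrogate η (iterate σ (fun _ => U) g b s) (g s) (expertIterate σ U g b η s) -
          surrogate η (iterate σ (fun _ => U) g b s) (g s) u) 0 T ≤
      (‖u‖ ^ 2 / σ ^ 2 - quad ((state σ (fun _ => U) g b T).Lam η)
        ((state σ (fun _ => U) g b T).wCheck η - u)) / 2 +
      activeSum b η (fun s => 2 * η ^ 2 * quad ((state σ (fun _ => U) g b s).Sig η) (g s)) 0 T := by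
  induction T with
  | zero =>
    rw [activeSum_self, activeSum_self]
    have : quad ((state σ (fun _ => U) g b 0).Lam η)
        ((state σ (fun _ => U) g b 0).wCheck η - u) = ‖u‖ ^ 2 / σ ^ 2 := by
      simp only [state, initState, quad, mulV_smul_one, inner_smul_right]
      rw [real_inner_self_eq_norm_sq, zero_sub, norm_neg]
      ring
    rw [this]
    simp
  | succ t ih =>
    have ih := ih fun s h1 h2 => hη s h1 (by lia)
    by_cases h : η ∈ activeSet b (t + 1)
    · rw [activeSum_succ_of_mem (Nat.zero_le _) h, activeSum_succ_of_mem (Nat.zero_le _) h]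
      obtain ⟨h1, h2, h3⟩ := state_succ_of_mem (σ := σ) (U := U) (g := g) h
      have hround := (isPrecisionPair_state hσ U g b η t).surrogate_sub_le hconv
        (isProjection_project hU ⟨u, hu⟩ _ ((state σ (fun _ => U) g b t).wCheck η)) hu
        (hη (t + 1) (by lia) le_rfl)
      rw [h1, h2, h3]
      refine (add_le_add ih hround).trans (le_of_eq ?_)
      simp only [expertIterate, expertPred, Nat.add_sub_cancel]
      ring
    · rw [activeSum_succ_of_notMem (Nat.zero_le _) h, activeSum_succ_of_notMem (Nat.zero_le _) h]
      obtain ⟨h1, h2, h3, -⟩ := state_succ_of_notMem (σ := σ) (U := U) (g := g) h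
      rwa [h1, h3]

/-- Cruder than the logarithmic bound, but proportional to `η²`, so it can be merged with the
variance. -/
lemma activeSum_quad_le_trace (hσ : 0 < σ) {G : ℝ} {T : ℕ}
    (hg : ∀ s, 1 ≤ s → s ≤ T → ‖g s‖ ≤ G) :
    activeSum b η (fun s => 2 * η ^ 2 * quad ((state σ (fun _ => U) g b s).Sig η) (g s)) 0 T ≤
      2 * η ^ 2 * (σ ^ 2 * G ^ 2 * T) := by
  have h1 : ∀ s, 0 < s → s ≤ T → η ∈ activeSet b s →
      2 * η ^ 2 * quad ((state σ (fun _ => U) g b s).Sig η) (g s) ≤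
        2 * η ^ 2 * (σ ^ 2 * G ^ 2) := by
    intro s hs hsT _
    refine mul_le_mul_of_nonneg_left ?_ (by positivity)
    refine ((isPrecisionPair_state hσ U g b η s).quad_cov_le hσ _).trans ?_
    exact mul_le_mul_of_nonneg_left (pow_le_pow_left₀ (norm_nonneg _) (hg s hs hsT) 2) (sq_nonneg σ)
  refine (activeSum_le h1).trans ((activeSum_le_sum fun _ _ _ => by positivity).trans ?_)
  rw [Finset.sum_const, Nat.card_Ioc, nsmul_eq_mul, Nat.sub_zero]
  exact le_of_eq (by ring)

lemma activeSum_quad_le_log_det_sub (hσ : 0 < σ) (T : ℕ) :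
    activeSum b η (fun s => 2 * η ^ 2 * quad ((state σ (fun _ => U) g b s).Sig η) (g s)) 0 T ≤
      Real.log ((state σ (fun _ => U) g b T).Lam η).det -
        Real.log ((state σ (fun _ => U) g b 0).Lam η).det := by
  induction T with
  | zero => rw [activeSum_self, sub_self]
  | succ t ih =>
    by_cases h : η ∈ activeSet b (t + 1)
    · rw [activeSum_succ_of_mem (Nat.zero_le _) h]
      obtain ⟨h1, h2, h3⟩ := state_succ_of_mem (σ := σ) (U := U) (g := g) h
      have := (isPrecisionPair_state hσ U g b η t).two_mul_sq_mul_quad_le_log hσ η (g (t + 1))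
      rw [h1, h2]
      linarith
    · rw [activeSum_succ_of_notMem (Nat.zero_le _) h]
      rwa [(state_succ_of_notMem (σ := σ) (U := U) (g := g) h).1]

lemma trace_state_le {G : ℝ} {T : ℕ} (hg : ∀ s, 1 ≤ s → s ≤ T → ‖g s‖ ≤ G) :
    ((state σ (fun _ => U) g b T).Lam η).trace ≤ d / σ ^ 2 + 2 * η ^ 2 * (G ^ 2 * T) := by
  induction T with
  | zero =>
    refine le_of_eq ?_
    simp only [state, initState, Matrix.trace_smul, Matrix.trace_one, Fintype.card_fin,
      smul_eq_mul, Nat.cast_zero]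
    ring
  | succ t ih =>
    have ih := ih fun s h1 h2 => hg s h1 (by lia)
    push_cast
    by_cases h : η ∈ activeSet b (t + 1)
    · rw [(state_succ_of_mem (σ := σ) (U := U) (g := g) h).1, trace_lamUpdate]
      have hn := pow_le_pow_left₀ (norm_nonneg _) (hg (t + 1) (by lia) le_rfl) 2
      have := mul_le_mul_of_nonneg_left hn (show 0 ≤ 2 * η ^ 2 by positivity)
      linarith
    · rw [(state_succ_of_notMem (σ := σ) (U := U) (g := g) h).1]
      have : 0 ≤ 2 * η ^ 2 * G ^ 2 := by positivity
      linarith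

/-- The terms telescope to a log-determinant ratio. The final determinant is controlled by the
trace, and the factors `1 / σ²` of the two determinants cancel. -/
lemma activeSum_quad_le_log (hd : 0 < d) (hσ : 0 < σ) {G : ℝ} {T : ℕ}
    (hg : ∀ s, 1 ≤ s → s ≤ T → ‖g s‖ ≤ G) :
    activeSum b η (fun s => 2 * η ^ 2 * quad ((state σ (fun _ => U) g b s).Sig η) (g s)) 0 T ≤
      d * Real.log (1 + 2 * η ^ 2 * (σ ^ 2 * G ^ 2 * T) / d) := by
  have hd' : (0 : ℝ) < d := by exact_mod_cast hd
  refine (activeSum_quad_le_log_det_sub hσ T).trans ?_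
  have hQ : 0 < 1 + 2 * η ^ 2 * (σ ^ 2 * G ^ 2 * T) / d := by positivity
  have h0 : Real.log ((state σ (fun _ => U) g b 0).Lam η).det = d * Real.log (1 / σ ^ 2) := by
    simp only [state, initState, Matrix.det_smul, Matrix.det_one, Fintype.card_fin, mul_one,
      Real.log_pow]
  have hT := log_det_le ((isPrecisionPair_state hσ U g b η T).posDef hσ)
    (m := (1 + 2 * η ^ 2 * (σ ^ 2 * G ^ 2 * T) / d) * (1 / σ ^ 2)) (by positivity)
    ((trace_state_le hg).trans (le_of_eq (by field_simp)))
  rw [Real.log_mul hQ.ne' (by positivity)] at hT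
  rw [h0]
  linarith

/-- The regret of an expert with respect to its surrogate losses. -/
lemma expert_regret_le (hσ : 0 < σ) (hU : IsCompact U) (hconv : Convex ℝ U) {u : Vec d}
    (hu : u ∈ U) (huσ : ‖u‖ ≤ σ) {T : ℕ}
    (hη : ∀ s, 1 ≤ s → s ≤ T → |η * inner ℝ (expertIterate σ U g b η s -
      iterate σ (fun _ => U) g b s) (g s)| ≤ 1 / 2) :
    activeSum b η (fun s =>
        surrogate η (iterate σ (fun _ => U) g b s) (g s) (expertIterate σ U g b η s) -
          surrogate η (iterate σ (fun _ => U) g b s) (g s) u) 0 T ≤ 1 / 2 +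
      activeSum b η (fun s => 2 * η ^ 2 * quad ((state σ (fun _ => U) g b s).Sig η) (g s)) 0 T := by
  have h := expert_regret_le_aux (b := b) hσ hU hconv hu hη
  have h0 := (isPrecisionPair_state hσ U g b η T).quad_nonneg
    ((state σ (fun _ => U) g b T).wCheck η - u)
  have h1 : ‖u‖ ^ 2 / σ ^ 2 ≤ 1 := by
    rw [div_le_one (by positivity)]
    exact pow_le_pow_left₀ (norm_nonneg _) huσ 2
  linarith

end expert

/-! ## The schedule of active learning rates -/

section schedule

variable {b : ℕ → ℝ} {η : ℝ} {r s t T : ℕ}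

lemma runMax_mono (b : ℕ → ℝ) : Monotone (runMax b) :=
  monotone_nat_of_le_succ fun _ => le_max_left _ _

lemma runMax_nonneg (b : ℕ → ℝ) (t : ℕ) : 0 ≤ runMax b t := runMax_mono b (Nat.zero_le t)

lemma le_runMax (b : ℕ → ℝ) (hs : 1 ≤ s) : b s ≤ runMax b s := by
  obtain ⟨s, rfl⟩ := Nat.exists_eq_add_of_le' hs
  exact le_max_right _ _

lemma runMax_le {M : ℝ} (hM : 0 ≤ M) (h : ∀ s, 1 ≤ s → s ≤ t → b s ≤ M) : runMax b t ≤ M := by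
  induction t with
  | zero => exact hM
  | succ t ih => exact max_le (ih fun s h1 h2 => h s h1 (by lia)) (h _ (by lia) le_rfl)

/-- The effective horizon, whose reciprocal is a lower bound on the active learning rates. -/
def horizon (b : ℕ → ℝ) (t : ℕ) : ℝ :=
  ∑ s ∈ Finset.Icc 1 (t - 1), b s * (runMax b (s - 1) / runMax b s) + runMax b (t - 1)

lemma clip_nonneg (b : ℕ → ℝ) (s : ℕ) : 0 ≤ runMax b (s - 1) / runMax b s :=
  div_nonneg (runMax_nonneg _ _) (runMax_nonneg _ _)

lemma clip_le_one (b : ℕ → ℝ) (s : ℕ) : runMax b (s - 1) / runMax b s ≤ 1 :=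
  div_le_one_of_le₀ (runMax_mono b (Nat.sub_le _ _)) (runMax_nonneg _ _)

lemma runMax_le_horizon (hb : ∀ s, 1 ≤ s → s ≤ T → 0 ≤ b s) (ht : t ≤ T + 1) :
    runMax b (t - 1) ≤ horizon b t := by
  refine le_add_of_nonneg_left (Finset.sum_nonneg fun s hs => ?_)
  rw [Finset.mem_Icc] at hs
  exact mul_nonneg (hb s hs.1 (by lia)) (clip_nonneg b s)

lemma horizon_mono (hb : ∀ s, 1 ≤ s → s ≤ T → 0 ≤ b s) (hrs : r ≤ s) (hs : s ≤ T + 1) :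
    horizon b r ≤ horizon b s := by
  refine add_le_add (Finset.sum_le_sum_of_subset_of_nonneg ?_ fun i hi _ => ?_)
    (runMax_mono b (by lia))
  · exact Finset.Icc_subset_Icc_right (by lia)
  · rw [Finset.mem_Icc] at hi
    exact mul_nonneg (hb i hi.1 (by lia)) (clip_nonneg b i)

lemma grid_pos (h : η ∈ grid) : 0 < η := by
  obtain ⟨i, rfl⟩ := h
  positivity

lemma mem_activeSet_iff (hb : ∀ s, 1 ≤ s → s ≤ T → 0 ≤ b s) (ht : t ≤ T + 1) :
    η ∈ activeSet b t ↔ 0 < runMax b (t - 1) ∧ η ∈ grid ∧ 1 < 2 * η * horizon b t ∧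
      2 * η * runMax b (t - 1) ≤ 1 := by
  have h := runMax_le_horizon hb ht
  change (_ ∧ _ ∧ 1 / (2 * horizon b t) < η ∧ _) ↔ _
  refine and_congr_right fun h0 => and_congr_right fun _ => ?_
  rw [div_lt_iff₀ (by linarith), le_div_iff₀ (by linarith)]
  constructor <;> rintro ⟨h1, h2⟩ <;> constructor <;> linarith

/-- The horizon grows, so the lower end of the active interval only decreases; a rate can leave only
by exceeding the upper end. -/
lemma mem_activeSet_of_mem (hb : ∀ s, 1 ≤ s → s ≤ T → 0 ≤ b s) (hrs : r ≤ s) (hs : s ≤ T + 1)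
    (h : η ∈ activeSet b r) (hη : 2 * η * runMax b (s - 1) ≤ 1) : η ∈ activeSet b s := by
  rw [mem_activeSet_iff hb (by lia)] at h ⊢
  obtain ⟨h1, h2, h3, h4⟩ := h
  have hη0 := grid_pos h2
  refine ⟨h1.trans_le (runMax_mono b (by lia)), h2, h3.trans_le ?_, hη⟩
  exact mul_le_mul_of_nonneg_left (horizon_mono hb hrs hs) (by linarith)

/-- This is the price of clipping in one round. Its right side telescopes. -/
lemma range_sub_clip_le (hs : 1 ≤ s) :
    b s * (1 - runMax b (s - 1) / runMax b s) ≤ runMax b s - runMax b (s - 1) := by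
  have h1 := mul_le_mul_of_nonneg_right (le_runMax b hs) (sub_nonneg.2 (clip_le_one b s))
  refine h1.trans (le_of_eq ?_)
  rcases (runMax_nonneg b s).eq_or_lt with h | h
  · have h0 : runMax b (s - 1) = 0 :=
      le_antisymm (h ▸ runMax_mono b (Nat.sub_le s 1)) (runMax_nonneg _ _)
    rw [← h, h0]
    simp
  · field_simp

lemma sum_runMax_sub (b : ℕ → ℝ) (r t : ℕ) (h : r ≤ t) :
    ∑ s ∈ Finset.Ioc r t, (runMax b s - runMax b (s - 1)) = runMax b t - runMax b r := by
  induction t, h using Nat.le_induction with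
  | base => simp
  | succ t ht ih =>
    rw [Finset.sum_Ioc_succ_top ht, ih, Nat.add_sub_cancel]
    ring

lemma Icc_one_eq_Ioc (t : ℕ) : Finset.Icc 1 t = Finset.Ioc 0 t := rfl

lemma sum_le_horizon (b : ℕ → ℝ) (t : ℕ) :
    ∑ s ∈ Finset.Ioc 0 (t - 1), b s ≤ horizon b t := by
  have h := Finset.sum_le_sum fun s (hs : s ∈ Finset.Ioc 0 (t - 1)) =>
    range_sub_clip_le (b := b) (Finset.mem_Ioc.1 hs).1
  rw [sum_runMax_sub b 0 _ (Nat.zero_le _)] at h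
  simp only [mul_sub, mul_one, Finset.sum_sub_distrib] at h
  rw [horizon, Icc_one_eq_Ioc]
  have : runMax b 0 = 0 := rfl
  linarith

/-- A learning rate that is inactive in round `t` because it is too small makes the contribution
of all rounds up to `t` negligible. -/
lemma mul_sum_le_one_of_notMem (hb : ∀ s, 1 ≤ s → s ≤ T → 0 ≤ b s) (hη : η ∈ grid)
    (hηT : 2 * η * runMax b T ≤ 1) (ht1 : 1 ≤ t) (ht : t ≤ T) (h : η ∉ activeSet b t) :
    η * ∑ s ∈ Finset.Ioc 0 t, b s ≤ 1 := by
  have hη0 := grid_pos hη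
  obtain ⟨t, rfl⟩ := Nat.exists_eq_add_of_le' ht1
  rw [Finset.sum_Ioc_succ_top (Nat.zero_le _), mul_add]
  have h1 : 2 * η * b (t + 1) ≤ 1 :=
    (mul_le_mul_of_nonneg_left ((le_runMax b ht1).trans (runMax_mono b ht)) (by linarith)).trans hηT
  have h2 : 2 * η * runMax b t ≤ 1 :=
    (mul_le_mul_of_nonneg_left (runMax_mono b (by lia)) (by linarith)).trans hηT
  suffices 2 * (η * ∑ s ∈ Finset.Ioc 0 t, b s) ≤ 1 by linarith
  rw [mem_activeSet_iff hb (by lia)] at h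
  rcases (runMax_nonneg b t).eq_or_lt with h0 | h0
  · have : ∑ s ∈ Finset.Ioc 0 t, b s ≤ 0 := by
      refine Finset.sum_nonpos fun s hs => ?_
      rw [Finset.mem_Ioc] at hs
      exact (le_runMax b hs.1).trans (h0 ▸ runMax_mono b hs.2)
    nlinarith
  · have h3 : 2 * η * horizon b (t + 1) ≤ 1 := by
      by_contra! h3
      exact h ⟨h0, hη, h3, h2⟩
    have := sum_le_horizon b (t + 1)
    rw [Nat.add_sub_cancel] at this
    nlinarith

/-- Only the last inactive round matters: up to it the full sum is already at most `1`, and active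
rounds afterwards leave the difference unchanged. -/
lemma sum_sub_activeSum_le (hb : ∀ s, 1 ≤ s → s ≤ T → 0 ≤ b s) (hη : η ∈ grid)
    (hηT : 2 * η * runMax b T ≤ 1) {F : ℕ → ℝ} (hF : ∀ s, 1 ≤ s → s ≤ T → F s ≤ η * b s)
    (ht : t ≤ T) : ∑ s ∈ Finset.Ioc 0 t, F s - activeSum b η F 0 t ≤ 1 := by
  have hη0 := grid_pos hη
  have hle : ∑ s ∈ Finset.Ioc 0 t, F s - activeSum b η F 0 t ≤
      ∑ s ∈ Finset.Ioc 0 t, η * b s - activeSum b η (fun s => η * b s) 0 t := by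
    simp only [activeSum, ← Finset.sum_sub_distrib]
    refine Finset.sum_le_sum fun s hs => ?_
    rw [Finset.mem_Ioc] at hs
    by_cases hm : η ∈ activeSet b s
    · simp [Set.indicator, hm]
    · simpa [Set.indicator, hm] using hF s hs.1 (by lia)
  refine hle.trans ?_
  clear hle
  induction t with
  | zero => simp [activeSum_self]
  | succ t ih =>
    by_cases hm : η ∈ activeSet b (t + 1)
    · rw [activeSum_succ_of_mem (Nat.zero_le _) hm, Finset.sum_Ioc_succ_top (Nat.zero_le _)]
      have := ih (by lia)
      linarith
    · have h1 := mul_sum_le_one_of_notMem hb hη hηT (by lia) ht hm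
      rw [← Finset.mul_sum]
      have h2 : 0 ≤ activeSum b η (fun s => η * b s) 0 (t + 1) := by
        refine Finset.sum_nonneg fun s hs => ?_
        rw [Finset.mem_Ioc] at hs
        exact Set.indicator_apply_nonneg fun _ => mul_nonneg hη0.le (hb s hs.1 (by lia))
      linarith

/-- Learning rates between two positive bounds. -/
lemma exists_finset_grid {lo hi : ℝ} (hlo : 0 < lo) (hle : lo ≤ hi) :
    ∃ E : Finset ℝ, (∀ η, η ∈ E ↔ η ∈ grid ∧ lo < η ∧ η ≤ hi) ∧
      (E.card : ℝ) ≤ Real.logb 2 (hi / lo) + 1 := by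
  have hhi := hlo.trans_le hle
  refine ⟨(Finset.Ioc ⌊Real.logb 2 lo⌋ ⌊Real.logb 2 hi⌋).image fun i : ℤ => (2 : ℝ) ^ i, ?_, ?_⟩
  · intro η
    simp only [Finset.mem_image, Finset.mem_Ioc, grid, Set.mem_range]
    have key : ∀ i : ℤ, (⌊Real.logb 2 lo⌋ < i ∧ i ≤ ⌊Real.logb 2 hi⌋) ↔
        (lo < (2 : ℝ) ^ i ∧ (2 : ℝ) ^ i ≤ hi) := by
      intro i
      rw [Int.floor_lt, Int.le_floor, Real.logb_lt_iff_lt_rpow one_lt_two hlo,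
        Real.le_logb_iff_rpow_le one_lt_two hhi, Real.rpow_intCast]
    constructor
    · rintro ⟨i, hi, rfl⟩
      exact ⟨⟨i, rfl⟩, (key i).1 hi⟩
    · rintro ⟨⟨i, rfl⟩, hi⟩
      exact ⟨i, (key i).2 hi, rfl⟩
  · have h1 : ((Finset.Ioc ⌊Real.logb 2 lo⌋ ⌊Real.logb 2 hi⌋).image
        fun i : ℤ => (2 : ℝ) ^ i).card ≤ (⌊Real.logb 2 hi⌋ - ⌊Real.logb 2 lo⌋).toNat :=
      Finset.card_image_le.trans (by rw [Int.card_Ioc])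
    have hfl : ⌊Real.logb 2 lo⌋ ≤ ⌊Real.logb 2 hi⌋ :=
      Int.floor_le_floor (Real.logb_le_logb_of_le one_lt_two hlo hle)
    have h2 : (((⌊Real.logb 2 hi⌋ - ⌊Real.logb 2 lo⌋).toNat : ℤ) : ℝ) =
        (⌊Real.logb 2 hi⌋ : ℝ) - ⌊Real.logb 2 lo⌋ := by
      rw [Int.toNat_of_nonneg (by lia)]
      push_cast
      ring
    have h3 := Int.floor_le (Real.logb 2 hi)
    have h4 := Int.lt_floor_add_one (Real.logb 2 lo)
    rw [Real.logb_div hhi.ne' hlo.ne']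
    have h5 : ((((Finset.Ioc ⌊Real.logb 2 lo⌋ ⌊Real.logb 2 hi⌋).image
        fun i : ℤ => (2 : ℝ) ^ i).card : ℕ) : ℝ) ≤
        (((⌊Real.logb 2 hi⌋ - ⌊Real.logb 2 lo⌋).toNat : ℕ) : ℝ) := by exact_mod_cast h1
    have h6 : (((⌊Real.logb 2 hi⌋ - ⌊Real.logb 2 lo⌋).toNat : ℕ) : ℝ) =
        (⌊Real.logb 2 hi⌋ : ℝ) - ⌊Real.logb 2 lo⌋ := by exact_mod_cast h2
    linarith

/-- The learning rates that are active in a round `τ < s ≤ t`. -/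
lemma exists_finset_activeSet_subset (hb : ∀ s, 1 ≤ s → s ≤ T → 0 ≤ b s) {τ : ℕ}
    (hτ : 0 < runMax b τ) (hτt : τ < t) (ht : t ≤ T + 1) :
    ∃ E : Finset ℝ, (∀ s, τ < s → s ≤ t → activeSet b s ⊆ E) ∧
      (∀ η ∈ E, 2 * η * runMax b τ ≤ 1) ∧
      (E.card : ℝ) ≤ Real.logb 2 (horizon b t / runMax b τ) + 1 := by
  have hτh : runMax b τ ≤ horizon b t :=
    (runMax_mono b (by lia)).trans (runMax_le_horizon hb ht)
  have hh : 0 < horizon b t := hτ.trans_le hτh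
  obtain ⟨E, hE, hcard⟩ := exists_finset_grid (lo := 1 / (2 * horizon b t))
    (hi := 1 / (2 * runMax b τ)) (by positivity)
    (one_div_le_one_div_of_le (by positivity) (by linarith))
  refine ⟨E, ?_, ?_, hcard.trans (le_of_eq ?_)⟩
  · intro s hτs hst η hη
    rw [mem_activeSet_iff hb (by lia)] at hη
    obtain ⟨h1, h2, h3, h4⟩ := hη
    have hη0 := grid_pos h2
    refine (hE η).2 ⟨h2, ?_, ?_⟩
    · rw [div_lt_iff₀ (by positivity)]
      have := mul_le_mul_of_nonneg_left (horizon_mono hb hst ht) (by linarith : 0 ≤ 2 * η)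
      linarith
    · rw [le_div_iff₀ (by positivity)]
      have := mul_le_mul_of_nonneg_left (runMax_mono b (by lia : τ ≤ s - 1))
        (by linarith : 0 ≤ 2 * η)
      linarith
  · intro η hη
    have := ((hE η).1 hη).2.2
    rw [le_div_iff₀ (by positivity)] at this
    linarith
  · congr 2
    field_simp

lemma exists_finset_eq_activeSet (hb : ∀ s, 1 ≤ s → s ≤ T → 0 ≤ b s) (ht1 : 1 ≤ t)
    (ht : t ≤ T + 1) : ∃ A : Finset ℝ, (A : Set ℝ) = activeSet b t := by
  suffices (activeSet b t).Finite from ⟨this.toFinset, this.coe_toFinset⟩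
  rcases (runMax_nonneg b (t - 1)).eq_or_lt with h0 | h0
  · have : activeSet b t = ∅ := Set.eq_empty_of_forall_notMem fun η hη => by
      have := hη.1
      linarith
    rw [this]
    exact Set.finite_empty
  · obtain ⟨E, hE, -⟩ := exists_finset_activeSet_subset hb h0 (by lia : t - 1 < t) ht
    exact E.finite_toSet.subset (hE t (by lia) le_rfl)

lemma sum_ratio_le (b : ℕ → ℝ) (t : ℕ) : ∑ s ∈ Finset.Icc 1 t, b s / runMax b s ≤ t := by
  have : ∀ s ∈ Finset.Icc 1 t, b s / runMax b s ≤ 1 := fun s hs =>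
    div_le_one_of_le₀ (le_runMax b (Finset.mem_Icc.1 hs).1) (runMax_nonneg _ _)
  refine (Finset.sum_le_sum this).trans ?_
  simp

lemma horizon_le (b : ℕ → ℝ) (n : ℕ) : horizon b (n + 1) ≤ (n + 1) * runMax b n := by
  have h : ∀ s ∈ Finset.Icc 1 n, b s * (runMax b (s - 1) / runMax b s) ≤ runMax b n := by
    intro s hs
    rw [Finset.mem_Icc] at hs
    refine (mul_le_mul_of_nonneg_right (le_runMax b hs.1) (clip_nonneg b s)).trans ?_
    refine (mul_le_of_le_one_right (runMax_nonneg _ _) (clip_le_one b s)).trans ?_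
    exact runMax_mono b hs.2
  have := Finset.sum_le_sum h
  rw [Finset.sum_const, Nat.card_Icc, nsmul_eq_mul, Nat.add_sub_cancel] at this
  rw [horizon, Nat.add_sub_cancel]
  linarith

end schedule

/-! ## The controller -/

/-- This inequality turns the surrogate's exponential into a linear function, which the tilted
average then annihilates. -/
lemma exp_neg_sub_sq_le {x : ℝ} (hx : |x| ≤ 1 / 2) : Real.exp (-(x + x ^ 2)) ≤ 1 - x := by
  obtain ⟨h1, h2⟩ := abs_le.1 hx
  rcases le_total 0 x with h | h
  · have he := Real.quadratic_le_exp_of_nonneg (show 0 ≤ x + x ^ 2 by positivity)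
    rw [Real.exp_neg]
    refine inv_le_of_inv_le₀ (by linarith) ?_
    refine le_trans ?_ he
    rw [inv_le_iff_one_le_mul₀ (by linarith)]
    have h3 : 0 ≤ (1 - x ^ 2) * (1 + x) - 2 * x := by nlinarith
    have h4 := mul_nonneg (sq_nonneg x) h3
    nlinarith
  · have h3 := Real.one_sub_inv_le_log_of_pos (show 0 < 1 - x by linarith)
    rw [← Real.le_log_iff_exp_le (by linarith)]
    refine le_trans ?_ h3
    rw [le_sub_comm, inv_le_iff_one_le_mul₀ (by linarith)]
    have : 0 ≤ x ^ 2 * (-x) := mul_nonneg (sq_nonneg x) (by linarith)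
    nlinarith

section controller

variable {d : ℕ} (σ : ℝ) (U : Set (Vec d)) (g : ℕ → Vec d) (b : ℕ → ℝ)

/-- The clipped surrogate loss of the `η`-expert in round `t`. -/
def clippedLoss (η : ℝ) (t : ℕ) : ℝ :=
  surrogate η (iterate σ (fun _ => U) g b t) (clippedGrad b g t) (expertIterate σ U g b η t)

variable {σ U g b} {η : ℝ} {t T τ n : ℕ}

open Classical in
lemma epoch_succ (t : ℕ) : (state σ (fun _ => U) g b (t + 1)).epoch =
    if NeedsReset b (state σ (fun _ => U) g b t).epoch (t + 1) then t + 1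
    else (state σ (fun _ => U) g b t).epoch := rfl

lemma epoch_le (t : ℕ) : (state σ (fun _ => U) g b t).epoch ≤ t := by
  induction t with
  | zero => exact le_rfl
  | succ t ih =>
    rw [epoch_succ]
    split_ifs
    · exact le_rfl
    · lia

lemma epoch_eq_epoch (s t : ℕ) (h1 : (state σ (fun _ => U) g b t).epoch ≤ s) (h2 : s ≤ t) :
    (state σ (fun _ => U) g b s).epoch = (state σ (fun _ => U) g b t).epoch := by
  induction t with
  | zero =>
    obtain rfl : s = 0 := by lia
    rfl
  | succ t ih =>
    rcases h2.eq_or_lt with rfl | h2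
    · rfl
    · rw [epoch_succ] at h1 ⊢
      split_ifs at h1 ⊢ with hr
      · lia
      · exact ih h1 (by lia)

lemma wt_succ_of_mem_of_reset (h : η ∈ activeSet b (t + 1))
    (hr : NeedsReset b (state σ (fun _ => U) g b t).epoch (t + 1)) :
    (state σ (fun _ => U) g b (t + 1)).wt η = 1 := by
  refine (if_pos h).trans (if_pos hr)

lemma wt_succ_of_mem_of_not_reset {A : Finset ℝ} (hA : (A : Set ℝ) = activeSet b (t + 1))
    (h : η ∈ A) (hr : ¬ NeedsReset b (state σ (fun _ => U) g b t).epoch (t + 1)) :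
    (state σ (fun _ => U) g b (t + 1)).wt η =
      (state σ (fun _ => U) g b t).wt η * Real.exp (-clippedLoss σ U g b η (t + 1)) /
        (∑ ν ∈ A, (state σ (fun _ => U) g b t).wt ν *
          Real.exp (-clippedLoss σ U g b ν (t + 1))) *
        ∑ ν ∈ A, (state σ (fun _ => U) g b t).wt ν := by
  have h' : η ∈ activeSet b (t + 1) := hA ▸ Finset.mem_coe.2 h
  rw [← finsum_mem_coe_finset, ← finsum_mem_coe_finset, hA]
  exact (if_pos h').trans (if_neg hr)

lemma wt_pos (hb : ∀ s, 1 ≤ s → s ≤ T → 0 ≤ b s) (ht : t ≤ T) (η : ℝ) :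
    0 < (state σ (fun _ => U) g b t).wt η := by
  induction t generalizing η with
  | zero => exact one_pos
  | succ t ih =>
    by_cases h : η ∈ activeSet b (t + 1)
    · by_cases hr : NeedsReset b (state σ (fun _ => U) g b t).epoch (t + 1)
      · rw [wt_succ_of_mem_of_reset h hr]
        exact one_pos
      · obtain ⟨A, hA⟩ := exists_finset_eq_activeSet hb (by lia : 1 ≤ t + 1) (by lia)
        have hηA : η ∈ A := by rw [← Finset.mem_coe, hA]; exact h
        rw [wt_succ_of_mem_of_not_reset hA hηA hr]
        have h1 : ∀ ν, 0 < (state σ (fun _ => U) g b t).wt ν := ih (by lia)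
        have h2 : 0 < ∑ ν ∈ A, (state σ (fun _ => U) g b t).wt ν :=
          Finset.sum_pos (fun ν _ => h1 ν) ⟨η, hηA⟩
        have h3 : 0 < ∑ ν ∈ A, (state σ (fun _ => U) g b t).wt ν *
            Real.exp (-clippedLoss σ U g b ν (t + 1)) :=
          Finset.sum_pos (fun ν _ => mul_pos (h1 ν) (Real.exp_pos _)) ⟨η, hηA⟩
        exact mul_pos (div_pos (mul_pos (h1 η) (Real.exp_pos _)) h3) h2
    · rw [(state_succ_of_notMem h).2.2.2]
      exact ih (by lia) η

/-- A rate active at the reset is set to `1`. An inactive one that is not too large has never been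
active, by persistence of activity, and keeps its initial `1`. The condition on `η` excludes retired
rates with stale weights. -/
lemma wt_epoch_eq_one (hb : ∀ s, 1 ≤ s → s ≤ T → 0 ≤ b s) (hτT : τ ≤ T)
    (hτ : (state σ (fun _ => U) g b τ).epoch = τ) (hη : 2 * η * runMax b τ ≤ 1) :
    (state σ (fun _ => U) g b τ).wt η = 1 := by
  cases τ with
  | zero => rfl
  | succ m =>
    by_cases h : η ∈ activeSet b (m + 1)
    · refine wt_succ_of_mem_of_reset h ?_
      by_contra hr
      rw [epoch_succ, if_neg hr] at hτ
      have := epoch_le (σ := σ) (U := U) (g := g) (b := b) m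
      lia
    · have hnot : ∀ r ≤ m + 1, η ∉ activeSet b r := by
        intro r hr hmem
        refine h (mem_activeSet_of_mem hb hr (by lia) hmem ?_)
        have hη0 := grid_pos hmem.2.1
        exact (mul_le_mul_of_nonneg_left (runMax_mono b (by lia)) (by linarith)).trans hη
      have hone : ∀ r ≤ m + 1, (state σ (fun _ => U) g b r).wt η = 1 := by
        intro r
        induction r with
        | zero => exact fun _ => rfl
        | succ r ih =>
          intro hr
          rw [(state_succ_of_notMem (hnot _ hr)).2.2.2]
          exact ih (by lia)
      exact hone _ le_rfl

lemma abs_mul_inner_expertIterate_le (hU : IsCompact U) (hne : U.Nonempty)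
    (hrange : ∀ s, 1 ≤ s → s ≤ T → IsRangeBound U (iterate σ (fun _ => U) g b s) (g s) (b s))
    (hη : 0 ≤ η) (ht1 : 1 ≤ t) (ht : t ≤ T) :
    |η * inner ℝ (expertIterate σ U g b η t - iterate σ (fun _ => U) g b t) (g t)| ≤ η * b t := by
  rw [abs_mul, abs_of_nonneg hη]
  exact mul_le_mul_of_nonneg_left (hrange t ht1 ht _ (expertIterate_mem hU hne t)) hη

lemma abs_mul_inner_clippedGrad_le (hU : IsCompact U) (hne : U.Nonempty)
    (hrange : ∀ s, 1 ≤ s → s ≤ T → IsRangeBound U (iterate σ (fun _ => U) g b s) (g s) (b s))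
    (ht1 : 1 ≤ t) (ht : t ≤ T) (h : η ∈ activeSet b t) :
    |η * inner ℝ (expertIterate σ U g b η t - iterate σ (fun _ => U) g b t) (clippedGrad b g t)| ≤
      1 / 2 := by
  have hη0 := grid_pos h.2.1
  rw [clippedGrad, inner_smul_right, mul_left_comm, abs_mul, abs_of_nonneg (clip_nonneg b t)]
  have h1 := mul_le_mul_of_nonneg_left
    (abs_mul_inner_expertIterate_le hU hne hrange hη0.le ht1 ht) (clip_nonneg b t)
  refine h1.trans ?_
  have h2 : runMax b (t - 1) / runMax b t * b t ≤ runMax b (t - 1) := by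
    rw [div_mul_eq_mul_div]
    exact div_le_of_le_mul₀ (runMax_nonneg _ _) (runMax_nonneg _ _)
      (mul_le_mul_of_nonneg_left (le_runMax b ht1) (runMax_nonneg _ _))
  have h3 := h.2.2.2
  rw [le_div_iff₀ (by linarith [h.1])] at h3
  have h4 := mul_le_mul_of_nonneg_left h2 hη0.le
  linarith

/-- The tilted average of the controller makes the total weight of the active experts
nonincreasing. -/
lemma sum_wt_mul_exp_le (hU : IsCompact U) (hne : U.Nonempty)
    (hb : ∀ s, 1 ≤ s → s ≤ T → 0 ≤ b s)
    (hrange : ∀ s, 1 ≤ s → s ≤ T → IsRangeBound U (iterate σ (fun _ => U) g b s) (g s) (b s))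
    (ht : t + 1 ≤ T) {A : Finset ℝ} (hA : (A : Set ℝ) = activeSet b (t + 1)) :
    ∑ ν ∈ A, (state σ (fun _ => U) g b t).wt ν * Real.exp (-clippedLoss σ U g b ν (t + 1)) ≤
      ∑ ν ∈ A, (state σ (fun _ => U) g b t).wt ν := by
  rcases A.eq_empty_or_nonempty with rfl | hAne
  · simp
  set p := (state σ (fun _ => U) g b t).wt with hp
  set y := fun ν => expertIterate σ U g b ν (t + 1) with hy
  set w := iterate σ (fun _ => U) g b (t + 1) with hw
  have hmem : ∀ ν ∈ A, ν ∈ activeSet b (t + 1) := fun ν hν => hA ▸ Finset.mem_coe.2 hν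
  have hppos : ∀ ν, 0 < p ν := wt_pos hb (by lia)
  have hW : 0 < ∑ ν ∈ A, p ν * ν :=
    Finset.sum_pos (fun ν hν => mul_pos (hppos ν) (grid_pos (hmem ν hν).2.1)) hAne
  have hw' : w = (∑ ν ∈ A, p ν * ν)⁻¹ • ∑ ν ∈ A, (p ν * ν) • y ν := by
    rw [← finsum_mem_coe_finset, ← finsum_mem_coe_finset, hA]
    refine if_neg ?_
    rw [← hA]
    exact_mod_cast hAne.ne_empty
  -- The reason for tilting the weights by `ν`: the linear parts of the surrogate losses cancel in
  -- the weighted sum.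
  have hmean : ∑ ν ∈ A, (p ν * ν) • (y ν - w) = 0 := by
    simp only [smul_sub, Finset.sum_sub_distrib]
    rw [← Finset.sum_smul, hw', smul_inv_smul₀ hW.ne', sub_self]
  have hzero : ∑ ν ∈ A, p ν * (ν * inner ℝ (y ν - w) (clippedGrad b g (t + 1))) = 0 := by
    rw [← inner_zero_left (𝕜 := ℝ) (clippedGrad b g (t + 1)), ← hmean, sum_inner]
    refine Finset.sum_congr rfl fun ν _ => ?_
    rw [real_inner_smul_left, mul_assoc]
  calc _ ≤ ∑ ν ∈ A, p ν * (1 - ν * inner ℝ (y ν - w) (clippedGrad b g (t + 1))) := by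
        refine Finset.sum_le_sum fun ν hν => mul_le_mul_of_nonneg_left ?_ (hppos ν).le
        exact exp_neg_sub_sq_le
          (abs_mul_inner_clippedGrad_le hU hne hrange (by lia) ht (hmem ν hν))
    _ = ∑ ν ∈ A, p ν := by
        simp only [mul_sub, mul_one, Finset.sum_sub_distrib, hzero, sub_zero]

lemma not_needsReset (hep : ∀ s, τ ≤ s → s ≤ n → (state σ (fun _ => U) g b s).epoch = τ)
    (h1 : τ ≤ t) (h2 : t + 1 ≤ n) : ¬ NeedsReset b τ (t + 1) := by
  intro hr
  have h3 := hep (t + 1) (by lia) h2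
  rw [epoch_succ, hep t h1 (by lia), if_pos hr] at h3
  lia

/-- Renormalization multiplies each updated weight by a factor at least `1`, because
`sum_wt_mul_exp_le` says that the total would otherwise not increase. -/
lemma exp_neg_activeSum_le_wt (hU : IsCompact U) (hne : U.Nonempty)
    (hb : ∀ s, 1 ≤ s → s ≤ T → 0 ≤ b s)
    (hrange : ∀ s, 1 ≤ s → s ≤ T → IsRangeBound U (iterate σ (fun _ => U) g b s) (g s) (b s))
    (hτn : τ ≤ n) (hn : n ≤ T)
    (hep : ∀ s, τ ≤ s → s ≤ n → (state σ (fun _ => U) g b s).epoch = τ)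
    (hη : 2 * η * runMax b τ ≤ 1) :
    Real.exp (-activeSum b η (clippedLoss σ U g b η) τ n) ≤
      (state σ (fun _ => U) g b n).wt η := by
  induction n, hτn using Nat.le_induction with
  | base =>
    rw [wt_epoch_eq_one hb hn (hep τ le_rfl le_rfl) hη, activeSum_self]
    simp
  | succ n hτn ih =>
    have ih := ih (by lia) fun s h1 h2 => hep s h1 (by lia)
    have hr := not_needsReset hep hτn le_rfl
    rw [← hep n hτn (by lia)] at hr
    by_cases h : η ∈ activeSet b (n + 1)
    · obtain ⟨A, hA⟩ := exists_finset_eq_activeSet hb (by lia : 1 ≤ n + 1) (by lia)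
      have hηA : η ∈ A := by rw [← Finset.mem_coe, hA]; exact h
      rw [wt_succ_of_mem_of_not_reset hA hηA hr, activeSum_succ_of_mem hτn h, neg_add,
        Real.exp_add]
      have hp : ∀ ν, 0 < (state σ (fun _ => U) g b n).wt ν := wt_pos hb (by lia)
      have hq : 0 < ∑ ν ∈ A, (state σ (fun _ => U) g b n).wt ν *
          Real.exp (-clippedLoss σ U g b ν (n + 1)) :=
        Finset.sum_pos (fun ν _ => mul_pos (hp ν) (Real.exp_pos _)) ⟨η, hηA⟩
      have hle := sum_wt_mul_exp_le hU hne hb hrange hn hA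
      rw [div_mul_eq_mul_div, le_div_iff₀ hq]
      have he := Real.exp_pos (-clippedLoss σ U g b η (n + 1))
      exact mul_le_mul (mul_le_mul_of_nonneg_right ih he.le) hle hq.le
        (mul_pos (hp η) he).le
    · rw [activeSum_succ_of_notMem hτn h, (state_succ_of_notMem h).2.2.2]
      exact ih

/-- `E` contains all rates used in the epoch, each starting at weight `1`. An update only
redistributes weight among the active ones. -/
lemma sum_wt_eq_card (hb : ∀ s, 1 ≤ s → s ≤ T → 0 ≤ b s) (hτn : τ ≤ n) (hn : n ≤ T)
    (hep : ∀ s, τ ≤ s → s ≤ n → (state σ (fun _ => U) g b s).epoch = τ)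
    {E : Finset ℝ} (hE : ∀ s, τ < s → s ≤ n → activeSet b s ⊆ E)
    (hEη : ∀ η ∈ E, 2 * η * runMax b τ ≤ 1) :
    ∑ ν ∈ E, (state σ (fun _ => U) g b n).wt ν = E.card := by
  induction n, hτn using Nat.le_induction with
  | base =>
    rw [Finset.sum_congr rfl fun ν hν => wt_epoch_eq_one hb hn (hep τ le_rfl le_rfl) (hEη ν hν)]
    simp
  | succ n hτn ih =>
    rw [← ih (by lia) (fun s h1 h2 => hep s h1 (by lia)) fun s h1 h2 => hE s h1 (by lia)]
    have hr := not_needsReset hep hτn le_rfl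
    rw [← hep n hτn (by lia)] at hr
    obtain ⟨A, hA⟩ := exists_finset_eq_activeSet hb (by lia : 1 ≤ n + 1) (by lia)
    have hAE : A ⊆ E := by
      rw [← Finset.coe_subset, hA]
      exact hE (n + 1) (by lia) le_rfl
    rw [← Finset.sum_sdiff hAE, ← Finset.sum_sdiff hAE]
    congr 1
    · refine Finset.sum_congr rfl fun ν hν => (state_succ_of_notMem ?_).2.2.2
      rw [← hA, Finset.mem_coe]
      exact (Finset.mem_sdiff.1 hν).2
    · rw [Finset.sum_congr rfl fun ν hν => wt_succ_of_mem_of_not_reset hA hν hr,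
        ← Finset.sum_mul, ← Finset.sum_div]
      rcases A.eq_empty_or_nonempty with rfl | hAne
      · simp
      have hp : ∀ ν, 0 < (state σ (fun _ => U) g b n).wt ν := wt_pos hb (by lia)
      have hq : 0 < ∑ ν ∈ A, (state σ (fun _ => U) g b n).wt ν *
          Real.exp (-clippedLoss σ U g b ν (n + 1)) :=
        Finset.sum_pos (fun ν _ => mul_pos (hp ν) (Real.exp_pos _)) hAne
      rw [div_self hq.ne', one_mul]

/-- The regret of the controller with respect to an expert, within a single epoch. -/
lemma neg_activeSum_clippedLoss_le (hU : IsCompact U) (hne : U.Nonempty)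
    (hb : ∀ s, 1 ≤ s → s ≤ T → 0 ≤ b s)
    (hrange : ∀ s, 1 ≤ s → s ≤ T → IsRangeBound U (iterate σ (fun _ => U) g b s) (g s) (b s))
    (hτn : τ ≤ n) (hn : n + 1 ≤ T)
    (hep : ∀ s, τ ≤ s → s ≤ n → (state σ (fun _ => U) g b s).epoch = τ)
    (hη : η ∈ grid) (hηT : 2 * η * runMax b T ≤ 1) :
    -activeSum b η (clippedLoss σ U g b η) τ (n + 1) ≤
      Real.log (2 * Real.logb 2 T + 1) := by
  have hη0 := grid_pos hη
  have hη' : ∀ s ≤ T, 2 * η * runMax b s ≤ 1 := fun s hs =>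
    (mul_le_mul_of_nonneg_left (runMax_mono b hs) (by linarith)).trans hηT
  have hT : (1 : ℝ) ≤ T := by exact_mod_cast (by lia : 1 ≤ T)
  have hlogb : 0 ≤ Real.logb 2 T := Real.logb_nonneg one_lt_two hT
  -- If `η` is inactive in the last round, persistence of activity shows that it was inactive
  -- throughout.
  by_cases hmem : η ∈ activeSet b (n + 1)
  swap
  · rw [activeSum_eq_zero, neg_zero]
    · exact Real.log_nonneg (by linarith)
    · intro s _ hs hs'
      exact hmem (mem_activeSet_of_mem hb hs (by lia) hs' (hη' _ (by lia)))
  have hBn : 0 < runMax b n := hmem.1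
  -- The failed reset test bounds the growth of `B`, since each ratio `b_s / B_s` is at most `1`.
  have hgrow : runMax b n ≤ runMax b τ * (n + 1) := by
    rcases hτn.eq_or_lt with rfl | hlt
    · nlinarith [runMax_nonneg b τ, (Nat.cast_nonneg τ : (0 : ℝ) ≤ τ)]
    · obtain ⟨m, rfl⟩ : ∃ m, n = m + 1 := ⟨n - 1, by lia⟩
      have h1 := not_lt.1 (not_needsReset hep (by lia : τ ≤ m) le_rfl)
      have h2 := mul_le_mul_of_nonneg_left (sum_ratio_le b (m + 1)) (runMax_nonneg b τ)
      nlinarith [runMax_nonneg b τ]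
  -- In particular the epoch `τ = 0` is excluded here, since `B_0 = 0`.
  have hBτ : 0 < runMax b τ := by
    by_contra! h
    have := mul_nonpos_of_nonpos_of_nonneg h (by positivity : (0 : ℝ) ≤ n + 1)
    linarith
  obtain ⟨E, hE, hEη, hcard⟩ := exists_finset_activeSet_subset hb hBτ (by lia : τ < n + 1)
    (by lia)
  have hcardT : (E.card : ℝ) ≤ 2 * Real.logb 2 T + 1 := by
    refine hcard.trans ?_
    have hle : horizon b (n + 1) / runMax b τ ≤ (T : ℝ) ^ 2 := by
      rw [div_le_iff₀ hBτ]
      have hnT : (n : ℝ) + 1 ≤ T := by exact_mod_cast hn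
      calc horizon b (n + 1) ≤ (n + 1) * runMax b n := horizon_le b n
        _ ≤ (n + 1) * (runMax b τ * (n + 1)) :=
          mul_le_mul_of_nonneg_left hgrow (by positivity)
        _ = (n + 1 : ℝ) ^ 2 * runMax b τ := by ring
        _ ≤ _ := mul_le_mul_of_nonneg_right (pow_le_pow_left₀ (by positivity) hnT 2) hBτ.le
    have hpos : 0 < horizon b (n + 1) / runMax b τ :=
      div_pos (hBn.trans_le (runMax_le_horizon hb (by lia : n + 1 ≤ T + 1))) hBτ
    have := Real.logb_le_logb_of_le one_lt_two hpos hle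
    rw [Real.logb_pow] at this
    push_cast at this
    linarith
  obtain ⟨A, hA⟩ := exists_finset_eq_activeSet hb (by lia : 1 ≤ n + 1) (by lia)
  have hηA : η ∈ A := by rw [← Finset.mem_coe, hA]; exact hmem
  have hAE : A ⊆ E := by
    rw [← Finset.coe_subset, hA]
    exact hE (n + 1) (by lia) le_rfl
  have hp : ∀ ν, 0 < (state σ (fun _ => U) g b n).wt ν := wt_pos hb (by lia)
  -- Round `n + 1` is treated before its weight update, which may be a reset that erases the
  -- weights.
  have hexp : Real.exp (-activeSum b η (clippedLoss σ U g b η) τ (n + 1)) ≤ E.card :=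
    calc _ = Real.exp (-activeSum b η (clippedLoss σ U g b η) τ n) *
          Real.exp (-clippedLoss σ U g b η (n + 1)) := by
          rw [activeSum_succ_of_mem hτn hmem, neg_add, Real.exp_add]
      _ ≤ (state σ (fun _ => U) g b n).wt η * Real.exp (-clippedLoss σ U g b η (n + 1)) :=
          mul_le_mul_of_nonneg_right (exp_neg_activeSum_le_wt hU hne hb hrange hτn (by lia) hep
            (hη' _ (by lia))) (Real.exp_pos _).le
      _ ≤ ∑ ν ∈ A, (state σ (fun _ => U) g b n).wt ν *
            Real.exp (-clippedLoss σ U g b ν (n + 1)) :=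
          Finset.single_le_sum (f := fun ν => (state σ (fun _ => U) g b n).wt ν *
            Real.exp (-clippedLoss σ U g b ν (n + 1)))
            (fun ν _ => (mul_pos (hp ν) (Real.exp_pos _)).le) hηA
      _ ≤ ∑ ν ∈ A, (state σ (fun _ => U) g b n).wt ν :=
          sum_wt_mul_exp_le hU hne hb hrange hn hA
      _ ≤ ∑ ν ∈ E, (state σ (fun _ => U) g b n).wt ν :=
          Finset.sum_le_sum_of_subset_of_nonneg hAE fun ν _ _ => (hp ν).le
      _ = E.card := sum_wt_eq_card hb hτn (by lia) hep (fun s h1 h2 => hE s h1 (by lia)) hEη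
  rw [Real.le_log_iff_exp_le (by linarith)]
  exact hexp.trans hcardT

end controller

/-! ## Regret for a fixed learning rate -/

section fixedRate

variable {d : ℕ} {σ : ℝ} {U : Set (Vec d)} {g : ℕ → Vec d} {b : ℕ → ℝ} {η : ℝ} {t T τ n : ℕ}

/-- Clipping by a factor `r ≤ 1` changes the linear part by at most `(1 - r) η b_t`, and it only
shrinks the square. -/
lemma neg_surrogate_le_clippedLoss (hU : IsCompact U) (hne : U.Nonempty)
    (hrange : ∀ s, 1 ≤ s → s ≤ T → IsRangeBound U (iterate σ (fun _ => U) g b s) (g s) (b s))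
    (hη : 0 ≤ η) (ht1 : 1 ≤ t) (ht : t ≤ T) :
    -surrogate η (iterate σ (fun _ => U) g b t) (g t) (expertIterate σ U g b η t) ≤
      -clippedLoss σ U g b η t + η * (runMax b t - runMax b (t - 1)) := by
  have habs := abs_mul_inner_expertIterate_le hU hne hrange hη ht1 ht
  have h0 := clip_nonneg b t
  have h1 := clip_le_one b t
  have h2 := mul_le_mul_of_nonneg_left (range_sub_clip_le (b := b) ht1) hη
  set r := runMax b (t - 1) / runMax b t with hr
  simp only [clippedLoss, surrogate, clippedGrad, inner_smul_right, ← hr]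
  set x := inner ℝ (expertIterate σ U g b η t - iterate σ (fun _ => U) g b t) (g t)
  have h3 := mul_le_mul_of_nonneg_right ((neg_abs_le _).trans' (neg_le_neg habs))
    (sub_nonneg.2 h1)
  have h4 : r ^ 2 * (η * x) ^ 2 ≤ (η * x) ^ 2 :=
    mul_le_of_le_one_left (sq_nonneg _) (pow_le_one₀ h0 h1)
  linarith

lemma activeSum_neg_surrogate_le (hU : IsCompact U) (hne : U.Nonempty)
    (hb : ∀ s, 1 ≤ s → s ≤ T → 0 ≤ b s)
    (hrange : ∀ s, 1 ≤ s → s ≤ T → IsRangeBound U (iterate σ (fun _ => U) g b s) (g s) (b s))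
    (hτn : τ ≤ n) (hn : n + 1 ≤ T)
    (hep : ∀ s, τ ≤ s → s ≤ n → (state σ (fun _ => U) g b s).epoch = τ)
    (hη : η ∈ grid) (hηT : 2 * η * runMax b T ≤ 1) :
    activeSum b η (fun s => -surrogate η (iterate σ (fun _ => U) g b s) (g s)
        (expertIterate σ U g b η s)) τ (n + 1) ≤
      Real.log (2 * Real.logb 2 T + 1) + η * (runMax b (n + 1) - runMax b τ) := by
  have hη0 := grid_pos hη
  refine (activeSum_le (H := fun s => -clippedLoss σ U g b η s +
    η * (runMax b s - runMax b (s - 1))) fun s h1 h2 _ =>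
      neg_surrogate_le_clippedLoss hU hne hrange hη0.le (by lia) (by lia : s ≤ T)).trans ?_
  rw [activeSum_add, activeSum_neg, ← sum_runMax_sub b τ (n + 1) (by lia), Finset.mul_sum]
  exact add_le_add (neg_activeSum_clippedLoss_le hU hne hb hrange hτn hn hep hη hηT)
    (activeSum_le_sum fun s _ _ =>
      mul_nonneg hη0.le (sub_nonneg.2 (runMax_mono b (Nat.sub_le _ _))))

/-- For `s ≤ τ` one has `B_τ b_s / B_s ≥ b_s`, so a reset makes one range dominate everything before
the epoch that it ends. -/
lemma sum_le_of_needsReset (hb : ∀ s, 1 ≤ s → s ≤ T → 0 ≤ b s) (hτt : τ ≤ t) (ht : t ≤ T)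
    (h : NeedsReset b τ t) : ∑ s ∈ Finset.Ioc 0 τ, b s ≤ runMax b t := by
  refine le_trans ?_ h.le
  rw [Finset.mul_sum]
  refine le_trans (Finset.sum_le_sum fun s hs => ?_) (Finset.sum_le_sum_of_subset_of_nonneg
    (Finset.Ioc_subset_Ioc_right hτt) fun s hs _ => ?_)
  · rw [Finset.mem_Ioc] at hs
    have hbs := hb s hs.1 (by lia)
    have hle := le_runMax b hs.1
    rcases (runMax_nonneg b s).eq_or_lt with h0 | h0
    · rw [← h0] at hle ⊢
      simpa using hle
    · rw [← mul_div_assoc, le_div_iff₀ h0, mul_comm]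
      exact mul_le_mul_of_nonneg_right (runMax_mono b hs.2) hbs
  · rw [Finset.mem_Icc] at hs
    exact mul_nonneg (runMax_nonneg _ _)
      (div_nonneg (hb s hs.1 (by lia)) (runMax_nonneg _ _))

/-- The regret of the controller with respect to an expert. All but the last two epochs are
negligible. -/
lemma activeSum_neg_surrogate_le_log (hU : IsCompact U) (hne : U.Nonempty)
    (hb : ∀ s, 1 ≤ s → s ≤ T → 0 ≤ b s)
    (hrange : ∀ s, 1 ≤ s → s ≤ T → IsRangeBound U (iterate σ (fun _ => U) g b s) (g s) (b s))
    (hT : 1 ≤ T) (hη : η ∈ grid) (hηT : 2 * η * runMax b T ≤ 1) :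
    activeSum b η (fun s => -surrogate η (iterate σ (fun _ => U) g b s) (g s)
        (expertIterate σ U g b η s)) 0 T ≤ 2 * Real.log (2 * Real.logb 2 T + 1) + 1 := by
  have hη0 := grid_pos hη
  have hT' : (1 : ℝ) ≤ T := by exact_mod_cast hT
  have hlogb : 0 ≤ Real.logb 2 T := Real.logb_nonneg one_lt_two hT'
  have hlog : 0 ≤ Real.log (2 * Real.logb 2 T + 1) := Real.log_nonneg (by linarith)
  obtain ⟨n, rfl⟩ := Nat.exists_eq_add_of_le' hT
  have hle := epoch_le (σ := σ) (U := U) (g := g) (b := b) n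
  have hlast := activeSum_neg_surrogate_le hU hne hb hrange hle le_rfl
    (fun s h1 h2 => epoch_eq_epoch s n h1 h2) hη hηT
  set τ := (state σ (fun _ => U) g b n).epoch with hτ
  have hBτ := mul_nonneg hη0.le (runMax_nonneg b τ)
  rcases Nat.eq_zero_or_pos τ with h0 | h0
  · rw [h0] at hlast hBτ
    linarith
  obtain ⟨m, hm⟩ := Nat.exists_eq_add_of_le' h0
  have hepm : (state σ (fun _ => U) g b (m + 1)).epoch = m + 1 := by
    rw [← hm]
    exact epoch_eq_epoch τ n le_rfl hle
  have hlem := epoch_le (σ := σ) (U := U) (g := g) (b := b) m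
  have hreset : NeedsReset b (state σ (fun _ => U) g b m).epoch (m + 1) := by
    by_contra hr
    rw [epoch_succ, if_neg hr] at hepm
    lia
  have hprev := activeSum_neg_surrogate_le hU hne hb hrange hlem (by lia)
    (fun s h1 h2 => epoch_eq_epoch s m h1 h2) hη hηT
  set τ' := (state σ (fun _ => U) g b m).epoch
  -- Rounds before the last two epochs are bounded trivially by `η b_s`; the reset ending the
  -- penultimate epoch bounds their total.
  have hold : activeSum b η (fun s => -surrogate η (iterate σ (fun _ => U) g b s) (g s)
      (expertIterate σ U g b η s)) 0 τ' ≤ η * runMax b (n + 1) := by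
    refine (activeSum_le (H := fun s => η * b s) fun s h1 h2 _ => ?_).trans
      ((activeSum_le_sum fun s h1 h2 => mul_nonneg hη0.le (hb s h1 (by lia))).trans ?_)
    · have := (neg_abs_le _).trans' (neg_le_neg
        (abs_mul_inner_expertIterate_le hU hne hrange hη0.le h1 (by lia : s ≤ n + 1)))
      have hsq := sq_nonneg (η * inner ℝ (expertIterate σ U g b η s -
        iterate σ (fun _ => U) g b s) (g s))
      simp only [surrogate]
      linarith
    · rw [← Finset.mul_sum]
      refine mul_le_mul_of_nonneg_left ?_ hη0.le
      exact (sum_le_of_needsReset hb (by lia) (by lia) hreset).trans (runMax_mono b (by lia))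
  rw [← activeSum_add_activeSum (Nat.zero_le τ) (by lia : τ ≤ n + 1),
    ← activeSum_add_activeSum (Nat.zero_le τ') (by lia : τ' ≤ τ)]
  rw [← hm] at hprev
  have hBτ' := mul_nonneg hη0.le (runMax_nonneg b τ')
  linarith

/-- The regret bound for a fixed learning rate. -/
lemma mul_linRegret_le (hσ : 0 < σ) (hU : IsCompact U) (hconv : Convex ℝ U)
    (hb : ∀ s, 1 ≤ s → s ≤ T → 0 ≤ b s)
    (hrange : ∀ s, 1 ≤ s → s ≤ T → IsRangeBound U (iterate σ (fun _ => U) g b s) (g s) (b s))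
    {u : Vec d} (hu : u ∈ U) (huσ : ‖u‖ ≤ σ) (hT : 1 ≤ T) (hη : η ∈ grid)
    (hηT : 2 * η * runMax b T ≤ 1) :
    η * linRegret (iterate σ (fun _ => U) g b) g T u ≤
      η ^ 2 * variance (iterate σ (fun _ => U) g b) g T u +
        (2 * Real.log (2 * Real.logb 2 T + 1) + 3) +
      activeSum b η (fun s => 2 * η ^ 2 * quad ((state σ (fun _ => U) g b s).Sig η) (g s)) 0 T := by
  have hη0 := grid_pos hη
  set w := iterate σ (fun _ => U) g b with hw
  have hexpert : ∀ s, 1 ≤ s → s ≤ T →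
      |η * inner ℝ (expertIterate σ U g b η s - w s) (g s)| ≤ 1 / 2 := by
    intro s h1 h2
    refine (abs_mul_inner_expertIterate_le hU ⟨u, hu⟩ hrange hη0.le h1 h2).trans ?_
    have := mul_le_mul_of_nonneg_left ((le_runMax b h1).trans (runMax_mono b h2)) hη0.le
    linarith
  have h1 := sum_sub_activeSum_le hb hη hηT (F := fun s => η * inner ℝ (w s - u) (g s))
    (fun s h1 h2 => by
      refine mul_le_mul_of_nonneg_left ?_ hη0.le
      have := (abs_le.1 (hrange s h1 h2 u hu)).1
      rw [← neg_sub, inner_neg_left]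
      linarith) le_rfl
  have h2 := expert_regret_le hσ hU hconv hu huσ hexpert
  have h3 := activeSum_neg_surrogate_le_log hU ⟨u, hu⟩ hb hrange hT hη hηT
  have h4 : activeSum b η (fun s => η ^ 2 * inner ℝ (u - w s) (g s) ^ 2) 0 T ≤
      η ^ 2 * variance w g T u := by
    rw [variance, Finset.mul_sum]
    exact activeSum_le_sum fun s _ _ => by positivity
  have h5 : activeSum b η (fun s => η * inner ℝ (w s - u) (g s)) 0 T =
      activeSum b η (fun s => surrogate η (w s) (g s) (expertIterate σ U g b η s) -
          surrogate η (w s) (g s) u) 0 T +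
        activeSum b η (fun s => -surrogate η (w s) (g s) (expertIterate σ U g b η s)) 0 T +
        activeSum b η (fun s => η ^ 2 * inner ℝ (u - w s) (g s) ^ 2) 0 T := by
    rw [← activeSum_add, ← activeSum_add]
    congr 1
    funext s
    have : inner ℝ (w s - u) (g s) = -inner ℝ (u - w s) (g s) := by
      rw [← inner_neg_left, neg_sub]
    rw [this]
    simp only [surrogate]
    ring
  rw [linRegret, Finset.mul_sum, Icc_one_eq_Ioc]
  linarith

end fixedRate

/-- Tuning the learning rate on the dyadic grid. -/
lemma le_of_forall_grid {R V A B : ℝ} (hV : 0 ≤ V) (hA : 0 < A) (hB : 0 < B)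
    (h : ∀ η ∈ grid, 2 * η * B ≤ 1 → η * R ≤ η ^ 2 * V + A) :
    R ≤ 3 * Real.sqrt (V * A) + 4 * B * A := by
  obtain ⟨x, hx, hxB, hxV, hxinv⟩ : ∃ x : ℝ, 0 < x ∧ 2 * x * B ≤ 1 ∧
      x * V ≤ Real.sqrt (V * A) ∧ A / x ≤ Real.sqrt (V * A) + 2 * B * A := by
    have hs := Real.sqrt_nonneg (V * A)
    have hss := Real.mul_self_sqrt (mul_nonneg hV hA.le)
    set q := Real.sqrt (V * A)
    have hBA : 0 < 2 * B * A := by positivity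
    -- The ideal rate is `√(A / V) = A / q`, capped at `1 / (2B)`. The capped case includes `V = 0`.
    -- Rounding `x` down to a power of two at most doubles `A / x`.
    by_cases hc : q ≤ 2 * B * A
    · refine ⟨1 / (2 * B), by positivity, by field_simp; exact le_rfl, ?_, ?_⟩
      · rw [div_mul_eq_mul_div, one_mul, div_le_iff₀ (by positivity)]
        nlinarith
      · rw [div_div_eq_mul_div, div_one]
        linarith
    · push Not at hc
      have hq : 0 < q := hBA.trans hc
      have hVpos : 0 < V := by
        by_contra! hV'
        nlinarith
      refine ⟨A / q, by positivity, ?_, ?_, ?_⟩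
      · rw [mul_div_assoc', div_mul_eq_mul_div, div_le_one hq]
        linarith
      · rw [div_mul_eq_mul_div, div_le_iff₀ hq]
        linarith
      · rw [div_div_cancel₀ hA.ne']
        linarith
  set η : ℝ := (2 : ℝ) ^ ⌊Real.logb 2 x⌋ with hηdef
  have hη0 : 0 < η := by positivity
  have hηx : η ≤ x := by
    have := Int.floor_le (Real.logb 2 x)
    rw [Real.le_logb_iff_rpow_le one_lt_two hx, Real.rpow_intCast] at this
    exact this
  have hxη : x ≤ 2 * η := by
    have := (Int.lt_floor_add_one (Real.logb 2 x)).le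
    rw [Real.logb_le_iff_le_rpow one_lt_two hx, Real.rpow_add two_pos, Real.rpow_intCast,
      Real.rpow_one] at this
    linarith
  have key := h η ⟨_, rfl⟩ ((mul_le_mul_of_nonneg_right (by linarith) hB.le).trans hxB)
  have hR : R ≤ η * V + A / η := by
    rw [← mul_le_mul_iff_right₀ hη0]
    refine key.trans (le_of_eq ?_)
    field_simp
  have h1 : η * V ≤ x * V := mul_le_mul_of_nonneg_right hηx hV
  have h2 : A / η ≤ 2 * (A / x) := by
    rw [mul_div_assoc', div_le_div_iff₀ hη0 hx]
    nlinarith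
  linarith

/-! ## Tuned regret bounds -/

section tuned

variable {d : ℕ} {U : Set (Vec d)} {g : ℕ → Vec d} {b : ℕ → ℝ} {D G : ℝ} {T : ℕ}

lemma linRegret_le_mul_runMax {w : ℕ → Vec d}
    (hrange : ∀ s, 1 ≤ s → s ≤ T → IsRangeBound U (w s) (g s) (b s)) {u : Vec d} (hu : u ∈ U) :
    linRegret w g T u ≤ T * runMax b T := by
  have h : ∀ s ∈ Finset.Icc 1 T, inner ℝ (w s - u) (g s) ≤ runMax b T := by
    intro s hs
    rw [Finset.mem_Icc] at hs
    have h1 := (abs_le.1 (hrange s hs.1 hs.2 u hu)).1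
    have h2 := (le_runMax b hs.1).trans (runMax_mono b hs.2)
    rw [← neg_sub, inner_neg_left]
    linarith
  refine (Finset.sum_le_sum h).trans ?_
  simp

lemma variance_nonneg (w g : ℕ → Vec d) (T : ℕ) (u : Vec d) : 0 ≤ variance w g T u :=
  Finset.sum_nonneg fun _ _ => sq_nonneg _

lemma variance_le {w : ℕ → Vec d} {M : ℝ}
    (hrange : ∀ s, 1 ≤ s → s ≤ T → IsRangeBound U (w s) (g s) (b s))
    (hM : ∀ s, 1 ≤ s → s ≤ T → b s ≤ M) {u : Vec d} (hu : u ∈ U) :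
    variance w g T u ≤ T * M ^ 2 := by
  have h : ∀ s ∈ Finset.Icc 1 T, inner ℝ (u - w s) (g s) ^ 2 ≤ M ^ 2 := by
    intro s hs
    rw [Finset.mem_Icc] at hs
    rw [← sq_abs]
    exact pow_le_pow_left₀ (abs_nonneg _)
      ((hrange s hs.1 hs.2 u hu).trans (hM s hs.1 hs.2)) 2
  refine (Finset.sum_le_sum h).trans ?_
  simp

lemma two_mul_logb_le {x : ℝ} (hx : 1 ≤ x) : 2 * Real.logb 2 x ≤ 3 * Real.log x := by
  have h2 := Real.log_two_gt_d9
  have hl := Real.log_nonneg hx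
  rw [Real.logb, mul_div_assoc', div_le_iff₀ (by linarith)]
  nlinarith

lemma log_log_three_pos : 0 < Real.log (Real.log 3) := by
  refine Real.log_pos ?_
  rw [Real.lt_log_iff_exp_lt (by norm_num)]
  exact Real.exp_one_lt_d9.trans (by norm_num)

/-- The worst-case regret bound. -/
lemma linRegret_le_worstCase
    (hU : IsCompact U) (hconv : Convex ℝ U) (hD : 0 < D) (hT : 1 ≤ T)
    (hb : ∀ s, 1 ≤ s → s ≤ T → 0 ≤ b s)
    (hrange : ∀ s, 1 ≤ s → s ≤ T → IsRangeBound U (iterate D (fun _ => U) g b s) (g s) (b s))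
    (hg : ∀ s, 1 ≤ s → s ≤ T → ‖g s‖ ≤ G) (hbDG : ∀ s, 1 ≤ s → s ≤ T → b s ≤ 2 * D * G)
    {u : Vec d} (hu : u ∈ U) (huD : ‖u‖ ≤ D)
    {C : ℝ} (hC : C = 7 / Real.log (Real.log 3) + 2) (hT3 : 3 ≤ T) :
    linRegret (iterate D (fun _ => U) g b) g T u ≤
      (3 * Real.sqrt (6 * C) + 8 * C) * (D * G * Real.sqrt (T * Real.log (Real.log T))) := by
  have hG : 0 ≤ G := (norm_nonneg _).trans (hg 1 le_rfl hT)
  have hT3' : (3 : ℝ) ≤ T := by exact_mod_cast hT3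
  have hκ := log_log_three_pos
  have hlog3 : 1 < Real.log 3 := by
    rw [Real.lt_log_iff_exp_lt (by norm_num)]
    exact Real.exp_one_lt_d9.trans (by norm_num)
  have hlogT : Real.log 3 ≤ Real.log T := Real.log_le_log (by norm_num) hT3'
  have hℓκ : Real.log (Real.log 3) ≤ Real.log (Real.log T) :=
    Real.log_le_log (by linarith) hlogT
  have hℓT : Real.log (Real.log T) ≤ T :=
    (Real.log_le_self (by linarith)).trans (Real.log_le_self (by linarith))
  have hCpos : 0 < C := by rw [hC]; positivity
  have hK : 2 * Real.log (2 * Real.logb 2 T + 1) + 3 ≤ C * Real.log (Real.log T) := by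
    have h1 := two_mul_logb_le (by linarith : (1 : ℝ) ≤ T)
    have h0 : 0 ≤ Real.logb 2 T := Real.logb_nonneg one_lt_two (by linarith)
    have h2 : Real.log (2 * Real.logb 2 T + 1) ≤ Real.log (4 * Real.log T) :=
      Real.log_le_log (by linarith) (by linarith)
    rw [Real.log_mul (by norm_num) (by linarith)] at h2
    have h4 : Real.log 4 ≤ 2 := by
      have : Real.log 4 = 2 * Real.log 2 := by
        rw [show (4 : ℝ) = 2 ^ 2 by norm_num, Real.log_pow]
        push_cast
        ring
      have := Real.log_two_lt_d9
      linarith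
    -- The constant `7` is `2 · 2 + 3`, with `ln 4 ≤ 2`; it is absorbed because `ln ln T ≥ ln ln 3 >
    -- 0`.
    have h5 : 7 ≤ 7 / Real.log (Real.log 3) * Real.log (Real.log T) := by
      rw [div_mul_eq_mul_div, le_div_iff₀ hκ]
      linarith
    rw [hC]
    linarith
  set ℓ := Real.log (Real.log T) with hℓ
  have hℓ0 : 0 < ℓ := hκ.trans_le hℓκ
  have hrhs : 0 ≤ (3 * Real.sqrt (6 * C) + 8 * C) * (D * G * Real.sqrt (T * ℓ)) := by positivity
  rcases (runMax_nonneg b T).eq_or_lt with hB | hB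
  · refine (linRegret_le_mul_runMax hrange hu).trans ?_
    rw [← hB, mul_zero]
    exact hrhs
  have hV := variance_le hrange hbDG hu
  have hV0 := variance_nonneg (iterate D (fun _ => U) g b) g T u
  have hBDG : runMax b T ≤ 2 * D * G := runMax_le (by positivity) hbDG
  have hA : 0 < C * ℓ := by positivity
  -- The trace bound enters through the variance slot, which totals at most `(4 + 2) D² G² T`.
  have htuned := le_of_forall_grid (R := linRegret (iterate D (fun _ => U) g b) g T u)
    (V := variance (iterate D (fun _ => U) g b) g T u + 2 * (D ^ 2 * G ^ 2 * T))
    (by positivity) hA hB fun η hη hηB => by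
      have h1 := mul_linRegret_le hD hU hconv hb hrange hu huD hT hη hηB
      have h2 := activeSum_quad_le_trace (b := b) (U := U) (η := η) hD hg
      linarith
  have hsqrt : Real.sqrt ((variance (iterate D (fun _ => U) g b) g T u +
      2 * (D ^ 2 * G ^ 2 * T)) * (C * ℓ)) ≤
      Real.sqrt (6 * C) * (D * G * Real.sqrt (T * ℓ)) := by
    have e : Real.sqrt (6 * C) * (D * G * Real.sqrt (T * ℓ)) =
        Real.sqrt (6 * C * ((D * G) ^ 2 * (T * ℓ))) := by
      rw [Real.sqrt_mul (by positivity : 0 ≤ 6 * C), Real.sqrt_mul (sq_nonneg (D * G)),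
        Real.sqrt_sq (by positivity)]
    rw [e]
    refine Real.sqrt_le_sqrt ?_
    have := mul_le_mul_of_nonneg_right hV hA.le
    linarith
  have hℓsqrt : ℓ ≤ Real.sqrt (T * ℓ) := by
    refine Real.le_sqrt_of_sq_le ?_
    rw [sq]
    exact mul_le_mul_of_nonneg_right hℓT hℓ0.le
  have hlast : 4 * runMax b T * (C * ℓ) ≤ 8 * C * (D * G * Real.sqrt (T * ℓ)) := by
    calc 4 * runMax b T * (C * ℓ) ≤ 4 * (2 * D * G) * (C * ℓ) := by gcongr
      _ = 8 * C * (D * G * ℓ) := by ring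
      _ ≤ _ := by gcongr
  linarith

/-- The regret bound in terms of the variance. -/
lemma linRegret_le_variance
    (hU : IsCompact U) (hconv : Convex ℝ U) (hD : 0 < D) (hT : 1 ≤ T)
    (hb : ∀ s, 1 ≤ s → s ≤ T → 0 ≤ b s)
    (hrange : ∀ s, 1 ≤ s → s ≤ T → IsRangeBound U (iterate D (fun _ => U) g b s) (g s) (b s))
    (hg : ∀ s, 1 ≤ s → s ≤ T → ‖g s‖ ≤ G) (hbDG : ∀ s, 1 ≤ s → s ≤ T → b s ≤ 2 * D * G)
    {u : Vec d} (hu : u ∈ U) (huD : ‖u‖ ≤ D)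
    {c Q A : ℝ} (hc : 0 < c) (hcDG : c ≤ D * G)
    (hcL : c ≤ Real.log (D * G * T / d)) (hQ : Q = 1 / c + 3 + 3 * (|Real.log c| / c))
    (hA : A = 7 * Q + 9 / c) :
    linRegret (iterate D (fun _ => U) g b) g T u ≤ (3 * Real.sqrt A + 8 * A + 2 / c) *
      (Real.sqrt (variance (iterate D (fun _ => U) g b) g T u *
        (d * Real.log (D * G * T / d))) + D * G * d * Real.log (D * G * T / d)) := by
  -- For `d = 0` the quotient and its logarithm both take the default value `0`, contradicting `0 <
  -- c ≤ L`.
  have hd : 0 < d := by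
    rcases Nat.eq_zero_or_pos d with h | h
    · rw [h, Nat.cast_zero, div_zero, Real.log_zero] at hcL
      linarith
    · exact h
  have hd1 : (1 : ℝ) ≤ d := by exact_mod_cast hd
  have hT' : (1 : ℝ) ≤ T := by exact_mod_cast hT
  have hDG : 0 < D * G := hc.trans_le hcDG
  have hQpos : 0 < Q := by rw [hQ]; positivity
  have hApos : 0 < A := by rw [hA]; positivity
  set L := Real.log (D * G * T / d) with hL
  have hL0 : 0 < L := hc.trans_le hcL
  have hLc : 1 ≤ L / c := by rwa [one_le_div hc]
  set V := variance (iterate D (fun _ => U) g b) g T u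
  have hV0 : 0 ≤ V := variance_nonneg _ _ _ _
  have hBDG : runMax b T ≤ 2 * D * G := runMax_le (by linarith) hbDG
  set B := runMax b T
  have hs : 0 ≤ Real.sqrt (V * (d * L)) := Real.sqrt_nonneg _
  have hDGdL : 0 ≤ D * G * d * L := by positivity
  -- Rates may be as large as `1 / (2B)`, so a tiny `B` would spoil the logarithm. In that case the
  -- trivial bound `T B` suffices; otherwise both `1` and `DG / B` are at most `T / d`.
  by_cases hsmall : T * B ≤ 2 * (D * G * d)
  · calc _ ≤ T * B := linRegret_le_mul_runMax hrange hu
      _ ≤ 2 * (D * G * d) := hsmall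
      _ ≤ 2 * (D * G * d) * (L / c) := le_mul_of_one_le_right (by positivity) hLc
      _ = 2 / c * (D * G * d * L) := by ring
      _ ≤ (3 * Real.sqrt A + 8 * A + 2 / c) * (D * G * d * L) := by
          refine mul_le_mul_of_nonneg_right ?_ hDGdL
          have : 0 ≤ Real.sqrt A := Real.sqrt_nonneg _
          linarith
      _ ≤ _ := mul_le_mul_of_nonneg_left (by linarith) (by positivity)
  push Not at hsmall
  have hB : 0 < B := by
    by_contra! h
    have := mul_nonpos_of_nonneg_of_nonpos (by linarith : (0 : ℝ) ≤ T) h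
    have : 0 < 2 * (D * G * d) := by positivity
    linarith
  set ρ : ℝ := T / d with hρ
  have hρ1 : 1 ≤ ρ := by
    rw [hρ, one_le_div (by linarith)]
    by_contra! h
    have h1 := mul_le_mul_of_nonneg_left hBDG (by linarith : (0 : ℝ) ≤ T)
    have h2 := mul_le_mul_of_nonneg_left h.le hDG.le
    linarith
  have hDGB : D * G / B ≤ ρ := by
    rw [hρ, div_le_div_iff₀ hB (by linarith)]
    have : 0 < D * G * d := by positivity
    linarith
  -- `L = ln(DG) + ln ρ`, and `DG` may be small but not below `c`; the excess `|ln c|` is absorbed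
  -- using `L ≥ c`.
  have hlogρ : Real.log ρ ≤ L * (1 + |Real.log c| / c) := by
    have h1 : L = Real.log (D * G) + Real.log ρ := by
      rw [hL, hρ, mul_div_assoc, Real.log_mul hDG.ne' (by positivity)]
    have h2 := Real.log_le_log hc hcDG
    have h3 := neg_abs_le (Real.log c)
    have h4 : |Real.log c| ≤ L * (|Real.log c| / c) := by
      rw [mul_div_assoc', le_div_iff₀ hc, mul_comm]
      exact mul_le_mul_of_nonneg_right hcL (abs_nonneg _)
    linarith
  have hLQ : 1 + 3 * Real.log ρ ≤ Q * L := by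
    have : 1 / c * L = L / c := by ring
    rw [hQ]
    linarith
  have hlogρ0 := Real.log_nonneg hρ1
  -- Here the iterated logarithm is crudely replaced by `ln T = ln ρ + ln d`, with `ln d ≤ d - 1`,
  -- which the factor `d L` can pay for.
  have hK : 2 * Real.log (2 * Real.logb 2 T + 1) + 3 ≤ (6 * Q + 9 / c) * (d * L) := by
    have h0 : 0 ≤ Real.logb 2 T := Real.logb_nonneg one_lt_two hT'
    have h1 := Real.log_le_sub_one_of_pos (by linarith : 0 < 2 * Real.logb 2 T + 1)
    have h2 := two_mul_logb_le hT'
    have h3 : Real.log T = Real.log ρ + Real.log d := by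
      rw [hρ, Real.log_div (by linarith) (by linarith)]
      ring
    have h4 : Real.log d ≤ d - 1 := Real.log_le_sub_one_of_pos (by linarith)
    have h5 : (d : ℝ) ≤ 1 / c * (d * L) := by
      have : 1 / c * (d * L) = d * (L / c) := by ring
      rw [this]
      exact le_mul_of_one_le_right (by linarith) hLc
    have h6 : Q * L ≤ Q * (d * L) := by
      have := mul_le_mul_of_nonneg_right hd1 (mul_pos hQpos hL0).le
      linarith
    have h7 : 9 / c * (d * L) = 9 * (1 / c * (d * L)) := by ring
    rw [add_mul, h7]
    linarith
  have hlogη : ∀ η : ℝ, 0 < η → 2 * η * B ≤ 1 →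
      Real.log (1 + 2 * η ^ 2 * (D ^ 2 * G ^ 2 * T) / d) ≤ Q * L := by
    intro η hη hηB
    have h1 : 2 * η * (D * G) ≤ ρ := by
      rw [div_le_iff₀ hB] at hDGB
      have := mul_le_mul_of_nonneg_left hDGB (by linarith : 0 ≤ 2 * η)
      have h' := mul_le_mul_of_nonneg_right hηB (by linarith : 0 ≤ ρ)
      linarith
    have h2 : (2 * η * (D * G)) ^ 2 ≤ ρ ^ 2 := pow_le_pow_left₀ (by positivity) h1 2
    -- The left side equals `(2ηDG)² ρ / 2`, and `2ηDG ≤ DG / B ≤ ρ`.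
    have h3 : 2 * η ^ 2 * (D ^ 2 * G ^ 2 * T) / d ≤ ρ ^ 3 := by
      have : 2 * η ^ 2 * (D ^ 2 * G ^ 2 * T) / d = (2 * η * (D * G)) ^ 2 * ρ / 2 := by
        rw [hρ]
        ring
      rw [this]
      have := mul_le_mul_of_nonneg_right h2 (by linarith : 0 ≤ ρ)
      have : 0 ≤ ρ ^ 3 := by positivity
      linarith
    have h4 : 1 ≤ ρ ^ 3 := one_le_pow₀ hρ1
    refine le_trans (Real.log_le_log (by positivity)
      (by linarith : _ ≤ 2 * ρ ^ 3)) ?_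
    rw [Real.log_mul two_ne_zero (by positivity), Real.log_pow]
    have := Real.log_two_lt_d9
    push_cast
    linarith
  have htuned := le_of_forall_grid (R := linRegret (iterate D (fun _ => U) g b) g T u)
    (V := V) (A := A * (d * L)) hV0 (by positivity) hB fun η hη hηB => by
      have h1 := mul_linRegret_le hD hU hconv hb hrange hu huD hT hη hηB
      have h2 := activeSum_quad_le_log (b := b) (U := U) (η := η) hd hD hg
      have h3 := mul_le_mul_of_nonneg_left (hlogη η (grid_pos hη) hηB)
        (by linarith : (0 : ℝ) ≤ d)
      rw [hA]
      linarith
  have hsqrt : Real.sqrt (V * (A * (d * L))) = Real.sqrt A * Real.sqrt (V * (d * L)) := by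
    rw [← Real.sqrt_mul hApos.le]
    congr 1
    ring
  have hlast : 4 * B * (A * (d * L)) ≤ 8 * A * (D * G * d * L) := by
    calc 4 * B * (A * (d * L)) ≤ 4 * (2 * D * G) * (A * (d * L)) := by gcongr
      _ = _ := by ring
  have h1 : 0 ≤ (8 * A + 2 / c) * Real.sqrt (V * (d * L)) := by positivity
  have h2 : 0 ≤ (3 * Real.sqrt A + 2 / c) * (D * G * d * L) := by positivity
  rw [hsqrt] at htuned
  linarith

end tuned

end MetaGrad

end

/-! ### The two regret bounds with explicit constants. -/

theorem corollary8 :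
    ∃ (C₁ : ℝ → ℝ) (C₂ : ℝ),
      ∀ (d : ℕ) (U : Set (MetaGrad.Vec d)) (D G : ℝ) (T : ℕ)
        (f : ℕ → MetaGrad.Vec d → ℝ) (g : ℕ → MetaGrad.Vec d) (b : ℕ → ℝ)
        (w : ℕ → MetaGrad.Vec d),
        -- the fixed domain, with radius `D`
        IsClosed U → Convex ℝ U → (0 : MetaGrad.Vec d) ∈ U →
        IsGreatest ((fun u => ‖u‖) '' U) D → 0 < D →
        -- the iterates of the algorithm, tuned with `σ = D`
        w = MetaGrad.iterate D (fun _ => U) g b →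
        -- losses, (sub)gradients and range bounds in each round
        (∀ t, 1 ≤ t → t ≤ T →
          ConvexOn ℝ U (f t) ∧ MetaGrad.IsSubgradient U (f t) (w t) (g t) ∧ ‖g t‖ ≤ G ∧
          MetaGrad.IsRangeBound U (w t) (g t) (b t) ∧ b t ≤ 2 * D * G) →
        ∀ u ∈ U,
          (∀ c : ℝ, 0 < c → c ≤ D * G → c ≤ Real.log (D * G * T / d) →
            MetaGrad.linRegret w g T u ≤
              C₁ c * (Real.sqrt (MetaGrad.variance w g T u * (d * Real.log (D * G * T / d)))
                + D * G * d * Real.log (D * G * T / d))) ∧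
          (3 ≤ T →
            MetaGrad.linRegret w g T u ≤
              C₂ * (D * G * Real.sqrt (T * Real.log (Real.log T)))) := by
  refine ⟨fun c => 3 * Real.sqrt (7 * (1 / c + 3 + 3 * (|Real.log c| / c)) + 9 / c) +
      8 * (7 * (1 / c + 3 + 3 * (|Real.log c| / c)) + 9 / c) + 2 / c,
    3 * Real.sqrt (6 * (7 / Real.log (Real.log 3) + 2)) +
      8 * (7 / Real.log (Real.log 3) + 2), ?_⟩
  intro d U D G T f g b w hclosed hconv h0 hgreatest hD hw hrounds u hu
  subst hw
  have hnorm : ∀ v ∈ U, ‖v‖ ≤ D := fun v hv => hgreatest.2 ⟨v, hv, rfl⟩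
  have hU : IsCompact U := by
    refine Metric.isCompact_of_isClosed_isBounded hclosed ?_
    exact (Metric.isBounded_closedBall (x := (0 : MetaGrad.Vec d)) (r := D)).subset fun v hv => by
      simpa using hnorm v hv
  have hrange := fun t h1 h2 => (hrounds t h1 h2).2.2.2.1
  have hg := fun t h1 h2 => (hrounds t h1 h2).2.2.1
  have hbDG := fun t h1 h2 => (hrounds t h1 h2).2.2.2.2
  have hb : ∀ t, 1 ≤ t → t ≤ T → 0 ≤ b t := fun t h1 h2 =>
    (abs_nonneg _).trans (hrange t h1 h2 0 h0)
  constructor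
  · intro c hc hcDG hcL
    have hT : 1 ≤ T := by
      by_contra! h
      obtain rfl : T = 0 := by lia
      rw [Nat.cast_zero, mul_zero, zero_div, Real.log_zero] at hcL
      linarith
    exact MetaGrad.linRegret_le_variance hU hconv hD hT hb hrange hg hbDG hu (hnorm u hu) hc hcDG
      hcL rfl rfl
  · intro hT
    exact MetaGrad.linRegret_le_worstCase hU hconv hD (by lia) hb hrange hg hbDG hu (hnorm u hu)
      rfl hT
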